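/- Let $c$ be a positive integer, let $\hbar,\mu,\nu\in\mathbb R$ with $\mu^2+\nu^2\neq 0$, let $\alpha>1$, and write $e(t)=e^{2\pi i t}$. Let $S^c$ be the space of smooth functions $\Phi:\mathbb R\times\mathbb T\times\mathbb Z\to\mathbb C$, $\mathbb T=\mathbb R/\mathbb Z$, with $\Phi(x+k,y,p)=e(ckpy)\,\Phi(x,y,p)$ for all $k\in\mathbb Z$, such that $P(p)\,\frac{\partial^{m+n}\Phi}{\partial x^m\partial y^n}$ is bounded on $K\times\mathbb Z$ for every polynomial $P$, all $m,n\ge 0$ and every compact $K\subset\mathbb R\times\mathbb T$. Let $\mathcal A=\mathcal A^\infty_\hbar$ be $S^c$ with the product $$(\Phi\star\Psi)(x,y,p)=\sum_{q\in\mathbb Z}\Phi(x-\hbar(q-p)\mu,\,y-\hbar(q-p)\nu,\,q)\,\Psi(x-\hbar q\mu,\,y-\hbar q\nu,\,p-q),$$ the involution $\Phi^*(x,y,p)=\overline{\Phi(x,y,-p)}$ and the trace $\tau(\Phi)=\int_0^1\!\int_{\mathbb T}\Phi(x,y,0)\,dx\,dy$. Put $\delta_j=i\,d_j$, where $$d_1f=-\frac{\partial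 f}{\partial x},\qquad d_2f=2\pi i c p x f-\frac{\partial f}{\partial y},\qquad d_3f=2\pi i p c\alpha f,$$ and $$\sigma_1=\begin{pmatrix}1&0\\0&-1\end{pmatrix},\qquad \sigma_2=\begin{pmatrix}0&-1\\-1&0\end{pmatrix},\qquad \sigma_3=\begin{pmatrix}0&i\\-i&0\end{pmatrix}.$$ Let $\mathcal H=L^2(\mathcal A,\tau)\otimes\mathbb C^2$, where $L^2(\mathcal A,\tau)$ is the completion of $\mathcal A$ for $\langle a,b\rangle=\tau(a^*b)$. The algebra $\mathcal A\otimes M_2(\mathbb C)$ acts on $\mathcal H$ by bounded operators ($\mathcal A$ by left multiplication), and $a\in\mathcal A$ is identified with $a\otimes 1$. Let $D=\sum_{j=1}^3\delta_j\otimes\sigma_j$, with domain $S^c\otimes\mathbb C^2$; the commutators $[D,a]$, $a\in\mathcal A$, are bounded. Let $\Omega^\bullet(\mathcal A)$ be the universal differential forms of $\mathcal A$ with differential $\delta$, let $\pi(a_0\,\delta a_1\cdots\delta a_k)=a_0[D,a_1]\cdots[D,a_k]$, let $J_k=\ker\pi|_{\Omega^k(\mathcal A)}$ and $J_{-1}=0$,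 let $$\Omega_D^k(\mathcal A)=\Omega^k(\mathcal A)/(J_k+\delta J_{k-1})\cong\pi(\Omega^k(\mathcal A))/\pi(\delta J_{k-1}),$$ and let $\tilde d:\Omega_D^k(\mathcal A)\to\Omega_D^{k+1}(\mathcal A)$ be the differential induced by $\delta$. Then, for every $a\in\mathcal A$, all the operators below lie in the respective spaces $\pi(\Omega^k(\mathcal A))$, and the following equalities of their classes hold. (i) In degree $0$, $\ \tilde d(a)=\sum_{j=1}^3\delta_j(a)\otimes\sigma_j$ in $\Omega_D^1(\mathcal A)$. (ii) In degree $1$, in $\Omega_D^2(\mathcal A)$, $$\tilde d(a\otimes\sigma_1)=\delta_2(a)\otimes\sigma_2\sigma_1+\delta_3(a)\otimes\sigma_3\sigma_1,$$ $$\tilde d(a\otimes\sigma_2)=\delta_1(a)\otimes\sigma_1\sigma_2+\delta_3(a)\otimes\sigma_3\sigma_2,$$ $$\tilde d(a\otimes\sigma_3)=\delta_1(a)\otimes\sigma_1\sigma_3+\delta_2(a)\otimes\sigma_2\sigma_3+\frac{i}{\alpha}\,a\otimes\sigma_1\sigma_2.$$ -/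

import Mathlib

namespace QHM

/-- `e(t) = exp(2πit)`. -/
noncomputable def e (t : ℝ) : ℂ := Complex.exp ((2 * Real.pi * t : ℝ) * Complex.I)

theorem e_add (s t : ℝ) : e (s + t) = e s * e t := by
  simp only [e, ← Complex.exp_add]
  congr 1
  push_cast
  ring

theorem e_zero : e 0 = 1 := by simp [e]

theorem norm_e (t : ℝ) : ‖e t‖ = 1 := Complex.norm_exp_ofReal_mul_I _

theorem hasDerivAt_e (t : ℝ) : HasDerivAt e (2 * Real.pi * Complex.I * e t) t := by
  have h1 : HasDerivAt (fun t : ℝ => 2 * Real.pi * t) (2 * Real.pi) t := by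
    simpa using (hasDerivAt_id t).const_mul (2 * Real.pi)
  have h2 := (h1.ofReal_comp.mul_const Complex.I).cexp
  refine (h2.congr_deriv ?_)
  simp only [e]
  push_cast
  ring

/-- Families `F p : ℝ × ℝ → E` of class `C^n`, all of whose derivatives of order at most `n`
decay faster than any power of `p`, uniformly on compact sets. -/
def Dec {E : Type*} [NormedAddCommGroup E] [NormedSpace ℝ E] (n : ℕ) (F : ℤ → ℝ × ℝ → E) : Prop :=
  (∀ p, ContDiff ℝ n (F p)) ∧
  ∀ m ≤ n, ∀ (N : ℕ) (K : Set (ℝ × ℝ)), IsCompact K →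
    ∃ C : ℝ, ∀ p : ℤ, ∀ z ∈ K, |(p : ℝ)| ^ N * ‖iteratedFDeriv ℝ m (F p) z‖ ≤ C

/-- Smooth families `F p : ℝ × ℝ → ℂ`, `p ∈ ℤ`, such that every derivative times every
polynomial in `p` is bounded on `K × ℤ` for every compact set `K`. (The derivative of order `m` is
bounded exactly when all partial derivatives of order `m` are.) -/
def IsRapid (F : ℤ → ℝ × ℝ → ℂ) : Prop :=
  (∀ p, ContDiff ℝ (⊤ : ℕ∞) (F p)) ∧
  ∀ (m N : ℕ) (K : Set (ℝ × ℝ)), IsCompact K →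
    ∃ C : ℝ, ∀ p : ℤ, ∀ z ∈ K, |(p : ℝ)| ^ N * ‖iteratedFDeriv ℝ m (F p) z‖ ≤ C

theorem isRapid_iff (F : ℤ → ℝ × ℝ → ℂ) : IsRapid F ↔ ∀ n, Dec n F := by
  constructor
  · intro h n
    exact ⟨fun p => contDiff_infty.1 (h.1 p) n, fun m _ => h.2 m⟩
  · intro h
    exact ⟨fun p => contDiff_infty.2 fun n => (h n).1 p, fun m => (h m).2 m le_rfl⟩

section DecLemmas

variable {E E' : Type*} [NormedAddCommGroup E] [NormedSpace ℝ E]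
  [NormedAddCommGroup E'] [NormedSpace ℝ E']

theorem Dec.add {n : ℕ} {F G : ℤ → ℝ × ℝ → E} (hF : Dec n F) (hG : Dec n G) :
    Dec n (fun p z => F p z + G p z) := by
  refine ⟨fun p => (hF.1 p).add (hG.1 p), fun m hm N K hK => ?_⟩
  obtain ⟨C, hC⟩ := hF.2 m hm N K hK
  obtain ⟨C', hC'⟩ := hG.2 m hm N K hK
  refine ⟨C + C', fun p z hz => ?_⟩
  have h1 : ContDiff ℝ m (F p) := (hF.1 p).of_le (by exact_mod_cast hm)
  have h2 : ContDiff ℝ m (G p) := (hG.1 p).of_le (by exact_mod_cast hm)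
  have : iteratedFDeriv ℝ m (fun z => F p z + G p z) z
      = iteratedFDeriv ℝ m (F p) z + iteratedFDeriv ℝ m (G p) z :=
    iteratedFDeriv_add_apply h1.contDiffAt h2.contDiffAt
  rw [this]
  calc |(p : ℝ)| ^ N * ‖iteratedFDeriv ℝ m (F p) z + iteratedFDeriv ℝ m (G p) z‖
      ≤ |(p : ℝ)| ^ N * (‖iteratedFDeriv ℝ m (F p) z‖ + ‖iteratedFDeriv ℝ m (G p) z‖) := by
        gcongr
        exact norm_add_le _ _
    _ ≤ C + C' := by
        rw [mul_add]
        exact add_le_add (hC p z hz) (hC' p z hz)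

theorem Dec.clm {n : ℕ} {F : ℤ → ℝ × ℝ → E} (hF : Dec n F) (L : E →L[ℝ] E') :
    Dec n (fun p z => L (F p z)) := by
  refine ⟨fun p => L.contDiff.comp (hF.1 p), fun m hm N K hK => ?_⟩
  obtain ⟨C, hC⟩ := hF.2 m hm N K hK
  refine ⟨‖L‖ * C, fun p z hz => ?_⟩
  have := L.norm_iteratedFDeriv_comp_left (x := z) (hF.1 p).contDiffAt
    (n := m) (by exact_mod_cast hm)
  calc |(p : ℝ)| ^ N * ‖iteratedFDeriv ℝ m (fun z => L (F p z)) z‖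
      ≤ |(p : ℝ)| ^ N * (‖L‖ * ‖iteratedFDeriv ℝ m (F p) z‖) := by
        gcongr
        exact this
    _ = ‖L‖ * (|(p : ℝ)| ^ N * ‖iteratedFDeriv ℝ m (F p) z‖) := by ring
    _ ≤ ‖L‖ * C := by
        gcongr
        exact hC p z hz

theorem Dec.mul_smooth {n : ℕ} {F : ℤ → ℝ × ℝ → ℂ} (hF : Dec n F) {g : ℝ × ℝ → ℂ}
    (hg : ContDiff ℝ n g) : Dec n (fun p z => g z * F p z) := by
  refine ⟨fun p => hg.mul (hF.1 p), fun m hm N K hK => ?_⟩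
  have hb : ∀ i : ℕ, ∃ B : ℝ, 0 ≤ B ∧ (i ≤ n → ∀ z ∈ K, ‖iteratedFDeriv ℝ i g z‖ ≤ B) := by
    intro i
    by_cases hi : i ≤ n
    · obtain ⟨B, hB⟩ := hK.exists_bound_of_continuousOn
        (hg.continuous_iteratedFDeriv (m := i) (by exact_mod_cast hi)).continuousOn
      exact ⟨max B 0, le_max_right _ _, fun _ z hz => (hB z hz).trans (le_max_left _ _)⟩
    · exact ⟨0, le_rfl, fun h => absurd h hi⟩
  choose B hB0 hB using hb
  have hc : ∀ i : ℕ, ∃ C : ℝ, i ≤ n → ∀ p : ℤ, ∀ z ∈ K,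
      |(p : ℝ)| ^ N * ‖iteratedFDeriv ℝ i (F p) z‖ ≤ C := by
    intro i
    by_cases hi : i ≤ n
    · obtain ⟨C, hC⟩ := hF.2 i hi N K hK
      exact ⟨C, fun _ => hC⟩
    · exact ⟨0, fun h => absurd h hi⟩
  choose C hC using hc
  refine ⟨∑ i ∈ Finset.range (m + 1), (m.choose i : ℝ) * B i * C (m - i), fun p z hz => ?_⟩
  have := norm_iteratedFDeriv_mul_le hg (hF.1 p) z (n := m) (by exact_mod_cast hm)
  calc |(p : ℝ)| ^ N * ‖iteratedFDeriv ℝ m (fun z => g z * F p z) z‖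
      ≤ |(p : ℝ)| ^ N * ∑ i ∈ Finset.range (m + 1),
          (m.choose i : ℝ) * ‖iteratedFDeriv ℝ i g z‖ * ‖iteratedFDeriv ℝ (m - i) (F p) z‖ := by
        gcongr
    _ = ∑ i ∈ Finset.range (m + 1), (m.choose i : ℝ) * ‖iteratedFDeriv ℝ i g z‖ *
          (|(p : ℝ)| ^ N * ‖iteratedFDeriv ℝ (m - i) (F p) z‖) := by
        rw [Finset.mul_sum]
        exact Finset.sum_congr rfl fun i _ => by ring
    _ ≤ _ := by
        refine Finset.sum_le_sum fun i hi => ?_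
        have hi' : i ≤ m := Nat.lt_succ_iff.1 (Finset.mem_range.1 hi)
        have h1 := hB i (hi'.trans hm) z hz
        have h2 := hC (m - i) ((Nat.sub_le _ _).trans hm) p z hz
        have h3 := hB0 i
        gcongr

theorem Dec.int_mul {n : ℕ} {F : ℤ → ℝ × ℝ → ℂ} (hF : Dec n F) :
    Dec n (fun p z => (p : ℂ) * F p z) := by
  refine ⟨fun p => contDiff_const.mul (hF.1 p), fun m hm N K hK => ?_⟩
  obtain ⟨C, hC⟩ := hF.2 m hm (N + 1) K hK
  refine ⟨C, fun p z hz => ?_⟩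
  have h1 : ContDiff ℝ m (F p) := (hF.1 p).of_le (by exact_mod_cast hm)
  have : iteratedFDeriv ℝ m (fun z => (p : ℂ) * F p z) z
      = (p : ℂ) • iteratedFDeriv ℝ m (F p) z :=
    iteratedFDeriv_const_smul_apply (a := (p : ℂ)) (x := z) h1.contDiffAt
  rw [this, norm_smul, Complex.norm_intCast, ← mul_assoc, ← pow_succ]
  exact hC p z hz

theorem Dec.of_fderiv {n : ℕ} {F : ℤ → ℝ × ℝ → E} (h0 : Dec 0 F)
    (hd : ∀ p, Differentiable ℝ (F p)) (h : Dec n (fun p z => fderiv ℝ (F p) z)) :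
    Dec (n + 1) F := by
  refine ⟨fun p => ?_, fun m hm N K hK => ?_⟩
  · have : ((n + 1 : ℕ) : WithTop ℕ∞) = (n : WithTop ℕ∞) + 1 := by push_cast; rfl
    rw [this, contDiff_succ_iff_fderiv]
    refine ⟨hd p, fun hn => ?_, h.1 p⟩
    exact absurd hn (by exact WithTop.coe_ne_top)
  · cases m with
    | zero => exact h0.2 0 le_rfl N K hK
    | succ m =>
      obtain ⟨C, hC⟩ := h.2 m (by omega) N K hK
      refine ⟨C, fun p z hz => ?_⟩
      rw [← norm_iteratedFDeriv_fderiv]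
      exact hC p z hz

theorem Dec.fderiv {n : ℕ} {F : ℤ → ℝ × ℝ → E} (hF : Dec (n + 1) F) :
    Dec n (fun p z => fderiv ℝ (F p) z) := by
  refine ⟨fun p => (hF.1 p).fderiv_right (by norm_cast), fun m hm N K hK => ?_⟩
  obtain ⟨C, hC⟩ := hF.2 (m + 1) (by omega) N K hK
  refine ⟨C, fun p z hz => ?_⟩
  rw [norm_iteratedFDeriv_fderiv]
  exact hC p z hz

theorem Dec.mono {n m : ℕ} {F : ℤ → ℝ × ℝ → E} (hF : Dec n F) (h : m ≤ n) : Dec m F :=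
  ⟨fun p => (hF.1 p).of_le (by exact_mod_cast h), fun i hi => hF.2 i (hi.trans h)⟩

end DecLemmas

/-- The space `S^c`. A function `Φ(x, y, p)` on `ℝ × 𝕋 × ℤ` is written `Φ p (x, y)`, and functions
on `𝕋 = ℝ/ℤ` are functions of period one. -/
noncomputable def S (c : ℕ) : Submodule ℂ (ℤ → ℝ × ℝ → ℂ) where
  carrier := {F | IsRapid F ∧ (∀ p x y, F p (x, y + 1) = F p (x, y)) ∧
    ∀ (k p : ℤ) x y, F p (x + k, y) = e (c * k * p * y) * F p (x, y)}
  add_mem' := by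
    rintro F G ⟨hF, hF1, hF2⟩ ⟨hG, hG1, hG2⟩
    refine ⟨(isRapid_iff _).2 fun n =>
      ((isRapid_iff _).1 hF n).add ((isRapid_iff _).1 hG n), fun p x y => ?_, fun k p x y => ?_⟩
    · simp [hF1, hG1]
    · simp [hF2, hG2, mul_add]
  zero_mem' := by
    refine ⟨⟨fun p => contDiff_const, fun m N K _ => ⟨0, fun p z _ => ?_⟩⟩, ?_, ?_⟩
    · have : (0 : ℤ → ℝ × ℝ → ℂ) p = fun _ => 0 := rfl
      rw [this]
      simp
    · simp
    · simp
  smul_mem' := by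
    rintro a F ⟨hF, hF1, hF2⟩
    refine ⟨(isRapid_iff _).2 fun n =>
      ((isRapid_iff _).1 hF n).mul_smooth (g := fun _ => a) contDiff_const,
      fun p x y => ?_, fun k p x y => ?_⟩
    · simp [hF1]
    · simp only [Pi.smul_apply, smul_eq_mul, hF2]
      ring

section Deriv

variable {c : ℕ} {F : ℤ → ℝ × ℝ → ℂ}

theorem S_dec (hF : F ∈ S c) (n : ℕ) : Dec n F := (isRapid_iff _).1 hF.1 n

theorem S_contDiff (hF : F ∈ S c) (p : ℤ) : ContDiff ℝ (⊤ : ℕ∞) (F p) := hF.1.1 p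

theorem S_diff (hF : F ∈ S c) (p : ℤ) : Differentiable ℝ (F p) :=
  (S_contDiff hF p).differentiable (by norm_num)

theorem hasFDerivAt_factor (a : ℝ) (z : ℝ × ℝ) :
    HasFDerivAt (fun w : ℝ × ℝ => e (a * w.2))
      ((2 * Real.pi * Complex.I * a * e (a * z.2)) •
        (Complex.ofRealCLM.comp (ContinuousLinearMap.snd ℝ ℝ ℝ))) z := by
  have h1 : HasFDerivAt (fun w : ℝ × ℝ => a * w.2)
      (a • ContinuousLinearMap.snd ℝ ℝ ℝ) z :=
    (ContinuousLinearMap.snd ℝ ℝ ℝ).hasFDerivAt.const_mul a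
  have h2 := (hasDerivAt_e (a * z.2)).hasFDerivAt.comp z h1
  refine h2.congr_fderiv ?_
  ext
  · simp
  · simp
    ring

theorem S_fderiv_add_one (hF : F ∈ S c) (p : ℤ) (x y : ℝ) :
    fderiv ℝ (F p) (x, y + 1) = fderiv ℝ (F p) (x, y) := by
  have h : (fun z : ℝ × ℝ => F p (z + (0, 1))) = F p := by
    ext ⟨x, y⟩
    simpa using hF.2.1 p x y
  have h2 := fderiv_comp_add_right (𝕜 := ℝ) (f := F p) (x := (x, y)) (0, 1)
  rw [h] at h2
  simpa using h2.symm

theorem S_fderiv_add_int (hF : F ∈ S c) (k p : ℤ) (x y : ℝ) :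
    fderiv ℝ (F p) (x + k, y) = e (c * k * p * y) • fderiv ℝ (F p) (x, y) +
      (2 * Real.pi * Complex.I * (c * k * p) * e (c * k * p * y) * F p (x, y)) •
        (Complex.ofRealCLM.comp (ContinuousLinearMap.snd ℝ ℝ ℝ)) := by
  have h : (fun z : ℝ × ℝ => F p (z + ((k : ℝ), 0))) =
      fun z => e (c * k * p * z.2) * F p z := by
    ext ⟨x, y⟩
    simpa using hF.2.2 k p x y
  have h2 := fderiv_comp_add_right (𝕜 := ℝ) (f := F p) (x := (x, y)) ((k : ℝ), (0 : ℝ))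
  rw [h] at h2
  have h3 := ((hasFDerivAt_factor (c * k * p) (x, y)).mul
    (S_diff hF p (x, y)).hasFDerivAt).fderiv
  have h4 := h2.symm.trans h3
  simp only [Prod.mk_add_mk, add_zero] at h4
  rw [h4]
  ext
  · simp
  · simp
    ring

theorem d1_mem (hF : F ∈ S c) : (fun p z => -fderiv ℝ (F p) z (1, 0)) ∈ S c := by
  refine ⟨(isRapid_iff _).2 fun n => ?_, fun p x y => ?_, fun k p x y => ?_⟩
  · exact (S_dec hF (n + 1)).fderiv.clm (-(ContinuousLinearMap.apply ℝ ℂ ((1 : ℝ), (0 : ℝ))))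
  · simp only [S_fderiv_add_one hF]
  · simp only [S_fderiv_add_int hF]
    simp

theorem d2_mem (hF : F ∈ S c) :
    (fun p z => 2 * Real.pi * Complex.I * c * p * z.1 * F p z - fderiv ℝ (F p) z (0, 1)) ∈ S c := by
  refine ⟨(isRapid_iff _).2 fun n => ?_, fun p x y => ?_, fun k p x y => ?_⟩
  · have h1 := (S_dec hF (n + 1)).fderiv.clm
      (-(ContinuousLinearMap.apply ℝ ℂ ((0 : ℝ), (1 : ℝ))))
    have h2 := (S_dec hF n).int_mul.mul_smooth
      (g := fun z => 2 * Real.pi * Complex.I * c * z.1)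
      (contDiff_const.mul (Complex.ofRealCLM.contDiff.comp contDiff_fst))
    convert h2.add h1 using 3
    simp
    ring
  · simp only [S_fderiv_add_one hF, hF.2.1]
  · simp only [S_fderiv_add_int hF, hF.2.2]
    simp
    ring

theorem d3_mem (hF : F ∈ S c) (α : ℝ) :
    (fun p z => 2 * Real.pi * Complex.I * p * c * α * F p z) ∈ S c := by
  refine ⟨(isRapid_iff _).2 fun n => ?_, fun p x y => ?_, fun k p x y => ?_⟩
  · have h2 := (S_dec hF n).int_mul.mul_smooth
      (g := fun _ => 2 * Real.pi * Complex.I * c * α) contDiff_const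
    convert h2 using 3
    ring
  · simp only [hF.2.1]
  · simp only [hF.2.2]
    ring

end Deriv

section Product

variable {c : ℕ} {F G : ℤ → ℝ × ℝ → ℂ}

/-- Summable weights on `ℤ`. -/
noncomputable def wt (q : ℤ) : ℝ := ((1 + |(q : ℝ)|) ^ 2)⁻¹

theorem wt_nonneg (q : ℤ) : 0 ≤ wt q := by
  unfold wt
  positivity

theorem summable_wt : Summable wt := by
  have h : Summable fun n : ℕ => wt (n : ℤ) := by
    have := (summable_nat_add_iff 1).2 (Real.summable_one_div_nat_pow.2 (one_lt_two))
    refine this.congr fun n => ?_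
    simp [wt, add_comm]
  refine Summable.of_nat_of_neg h (h.congr fun n => ?_)
  simp [wt]

theorem S_int_y (hF : F ∈ S c) (p m : ℤ) (x y : ℝ) : F p (x, y + m) = F p (x, y) := by
  have h : Function.Periodic (fun t => F p (x, t)) 1 := fun t => hF.2.1 p x t
  simpa using h.int_mul m y

theorem S_norm_fract (hF : F ∈ S c) (p : ℤ) (x y : ℝ) :
    ‖F p (x, y)‖ = ‖F p (Int.fract x, Int.fract y)‖ := by
  have h1 := hF.2.2 ⌊x⌋ p (Int.fract x) y
  rw [Int.fract_add_floor] at h1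
  have h2 := S_int_y hF p ⌊y⌋ (Int.fract x) (Int.fract y)
  rw [Int.fract_add_floor] at h2
  rw [h1, norm_mul, norm_e, one_mul, h2]

theorem S_bound (hF : F ∈ S c) (N : ℕ) :
    ∃ C : ℝ, 0 ≤ C ∧ ∀ (p : ℤ) (z : ℝ × ℝ), (1 + |(p : ℝ)|) ^ N * ‖F p z‖ ≤ C := by
  have hK : IsCompact (Set.Icc (0 : ℝ) 1 ×ˢ Set.Icc (0 : ℝ) 1) := isCompact_Icc.prod isCompact_Icc
  obtain ⟨C0, h0⟩ := hF.1.2 0 0 _ hK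
  obtain ⟨C1, h1⟩ := hF.1.2 0 N _ hK
  have key : ∀ (p : ℤ) (z : ℝ × ℝ), (1 + |(p : ℝ)|) ^ N * ‖F p z‖ ≤ 2 ^ (N - 1) * (C0 + C1) := by
    rintro p ⟨x, y⟩
    rw [S_norm_fract hF]
    have hz : ((Int.fract x, Int.fract y) : ℝ × ℝ) ∈ Set.Icc (0 : ℝ) 1 ×ˢ Set.Icc (0 : ℝ) 1 :=
      ⟨⟨Int.fract_nonneg _, (Int.fract_lt_one _).le⟩, ⟨Int.fract_nonneg _, (Int.fract_lt_one _).le⟩⟩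
    have h0' := h0 p _ hz
    have h1' := h1 p _ hz
    simp only [norm_iteratedFDeriv_zero, pow_zero, one_mul] at h0' h1'
    have h2 : (1 + |(p : ℝ)|) ^ N ≤ 2 ^ (N - 1) * (1 ^ N + |(p : ℝ)| ^ N) :=
      add_pow_le zero_le_one (abs_nonneg _) N
    calc (1 + |(p : ℝ)|) ^ N * ‖F p (Int.fract x, Int.fract y)‖
        ≤ 2 ^ (N - 1) * (1 ^ N + |(p : ℝ)| ^ N) * ‖F p (Int.fract x, Int.fract y)‖ := by gcongr
      _ = 2 ^ (N - 1) * (‖F p (Int.fract x, Int.fract y)‖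
            + |(p : ℝ)| ^ N * ‖F p (Int.fract x, Int.fract y)‖) := by
          rw [one_pow]
          ring
      _ ≤ _ := by gcongr
  exact ⟨_, le_trans (by positivity) (key 0 0), key⟩

theorem S_prod_bound (hF : F ∈ S c) (hG : G ∈ S c) (N : ℕ) :
    ∃ C : ℝ, 0 ≤ C ∧ ∀ (p q : ℤ) (z z' : ℝ × ℝ),
      (1 + |(p : ℝ)|) ^ N * ‖F q z * G (p - q) z'‖ ≤ C * wt q := by
  obtain ⟨A, hA0, hA⟩ := S_bound hF (N + 2)
  obtain ⟨B, hB0, hB⟩ := S_bound hG N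
  refine ⟨A * B, by positivity, fun p q z z' => ?_⟩
  have h1 : 1 + |(p : ℝ)| ≤ (1 + |(q : ℝ)|) * (1 + |((p - q : ℤ) : ℝ)|) := by
    have : |(p : ℝ)| ≤ |(q : ℝ)| + |((p - q : ℤ) : ℝ)| := by
      calc |(p : ℝ)| = |(q : ℝ) + ((p - q : ℤ) : ℝ)| := by
            congr 1
            push_cast
            ring
        _ ≤ _ := abs_add_le _ _
    nlinarith [abs_nonneg (q : ℝ), abs_nonneg ((p - q : ℤ) : ℝ)]
  have hq : 0 < 1 + |(q : ℝ)| := by positivity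
  calc (1 + |(p : ℝ)|) ^ N * ‖F q z * G (p - q) z'‖
      ≤ ((1 + |(q : ℝ)|) * (1 + |((p - q : ℤ) : ℝ)|)) ^ N * (‖F q z‖ * ‖G (p - q) z'‖) := by
        rw [norm_mul]
        gcongr
    _ = ((1 + |(q : ℝ)|) ^ (N + 2) * ‖F q z‖) *
          ((1 + |((p - q : ℤ) : ℝ)|) ^ N * ‖G (p - q) z'‖) * wt q := by
        unfold wt
        rw [mul_pow]
        field_simp
        ring
    _ ≤ A * B * wt q := by
        have := wt_nonneg q
        gcongr
        · exact hA q z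
        · exact hB _ z'

/-- The `q`-th term of the product, at the point `(z, p)`. -/
noncomputable def term (hb μ ν : ℝ) (F G : ℤ → ℝ × ℝ → ℂ) (p : ℤ) (z : ℝ × ℝ) (q : ℤ) : ℂ :=
  F q (z.1 - hb * (q - p) * μ, z.2 - hb * (q - p) * ν) *
    G (p - q) (z.1 - hb * q * μ, z.2 - hb * q * ν)

/-- The product
`(Φ ⋆ Ψ)(x,y,p) = ∑_q Φ(x - ħ(q-p)μ, y - ħ(q-p)ν, q) Ψ(x - ħqμ, y - ħqν, p-q)`. -/
noncomputable def conv (hb μ ν : ℝ) (F G : ℤ → ℝ × ℝ → ℂ) : ℤ → ℝ × ℝ → ℂ := fun p z =>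
  ∑' q : ℤ, F q (z.1 - hb * (q - p) * μ, z.2 - hb * (q - p) * ν) *
    G (p - q) (z.1 - hb * q * μ, z.2 - hb * q * ν)

variable {hb μ ν : ℝ}

theorem conv_eq (p : ℤ) (z : ℝ × ℝ) : conv hb μ ν F G p z = ∑' q, term hb μ ν F G p z q := rfl

theorem term_bound (hF : F ∈ S c) (hG : G ∈ S c) (N : ℕ) :
    ∃ C : ℝ, 0 ≤ C ∧ ∀ (p q : ℤ) (z : ℝ × ℝ),
      (1 + |(p : ℝ)|) ^ N * ‖term hb μ ν F G p z q‖ ≤ C * wt q := by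
  obtain ⟨C, h0, h⟩ := S_prod_bound hF hG N
  exact ⟨C, h0, fun p q z => h p q _ _⟩

theorem summable_term (hF : F ∈ S c) (hG : G ∈ S c) (p : ℤ) (z : ℝ × ℝ) :
    Summable (term hb μ ν F G p z) := by
  obtain ⟨C, -, h⟩ := term_bound (hb := hb) (μ := μ) (ν := ν) hF hG 0
  refine Summable.of_norm_bounded (summable_wt.mul_left C) fun q => ?_
  simpa using h p q z

theorem conv_bound (hF : F ∈ S c) (hG : G ∈ S c) (N : ℕ) :
    ∃ C : ℝ, ∀ (p : ℤ) (z : ℝ × ℝ), (1 + |(p : ℝ)|) ^ N * ‖conv hb μ ν F G p z‖ ≤ C := by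
  obtain ⟨C, -, h⟩ := term_bound (hb := hb) (μ := μ) (ν := ν) hF hG N
  refine ⟨∑' q, C * wt q, fun p z => ?_⟩
  have hs := (summable_term (hb := hb) (μ := μ) (ν := ν) hF hG p z).norm
  calc (1 + |(p : ℝ)|) ^ N * ‖conv hb μ ν F G p z‖
      ≤ (1 + |(p : ℝ)|) ^ N * ∑' q, ‖term hb μ ν F G p z q‖ := by
        gcongr
        exact norm_tsum_le_tsum_norm hs
    _ = ∑' q, (1 + |(p : ℝ)|) ^ N * ‖term hb μ ν F G p z q‖ := by rw [tsum_mul_left]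
    _ ≤ _ := (hs.mul_left _).tsum_le_tsum (fun q => h p q z) (summable_wt.mul_left C)

/-- `-∂/∂x`. -/
noncomputable def D1 (F : ℤ → ℝ × ℝ → ℂ) : ℤ → ℝ × ℝ → ℂ := fun p z => -fderiv ℝ (F p) z (1, 0)

/-- `2πicpx - ∂/∂y`. -/
noncomputable def D2 (c : ℕ) (F : ℤ → ℝ × ℝ → ℂ) : ℤ → ℝ × ℝ → ℂ := fun p z =>
  2 * Real.pi * Complex.I * c * p * z.1 * F p z - fderiv ℝ (F p) z (0, 1)

theorem fderiv_eq (p : ℤ) (z : ℝ × ℝ) : fderiv ℝ (F p) z =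
    (-D1 F p z) • (Complex.ofRealCLM.comp (ContinuousLinearMap.fst ℝ ℝ ℝ)) +
    (2 * Real.pi * Complex.I * c * p * z.1 * F p z - D2 c F p z) •
      (Complex.ofRealCLM.comp (ContinuousLinearMap.snd ℝ ℝ ℝ)) := by
  ext <;> simp [D1, D2]

theorem term_hasFDerivAt (hF : F ∈ S c) (hG : G ∈ S c) (p q : ℤ) (z : ℝ × ℝ) :
    HasFDerivAt (fun w => term hb μ ν F G p w q)
      ((-(term hb μ ν (D1 F) G p z q + term hb μ ν F (D1 G) p z q)) •
        (Complex.ofRealCLM.comp (ContinuousLinearMap.fst ℝ ℝ ℝ)) +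
      (2 * Real.pi * Complex.I * c * p * z.1 * term hb μ ν F G p z q -
        (term hb μ ν (D2 c F) G p z q + term hb μ ν F (D2 c G) p z q)) •
        (Complex.ofRealCLM.comp (ContinuousLinearMap.snd ℝ ℝ ℝ))) z := by
  have sh : ∀ (r : ℤ) (H : ℤ → ℝ × ℝ → ℂ) (s t : ℝ), H ∈ S c →
      HasFDerivAt (fun w : ℝ × ℝ => H r (w.1 - s, w.2 - t))
        (fderiv ℝ (H r) (z.1 - s, z.2 - t)) z := by
    intro r H s t hH
    have h1 := (S_diff hH r (z - (s, t))).hasFDerivAt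
    exact (h1.comp z ((hasFDerivAt_id z).sub_const ((s, t) : ℝ × ℝ))).congr_fderiv
      (ContinuousLinearMap.comp_id _)
  have h := (sh q F (hb * (q - p) * μ) (hb * (q - p) * ν) hF).mul
    (sh (p - q) G (hb * q * μ) (hb * q * ν) hG)
  refine h.congr_fderiv ?_
  rw [fderiv_eq (c := c) q, fderiv_eq (c := c) (p - q)]
  ext
  · simp [term]
    ring
  · simp [term]
    ring

theorem D1_mem (hF : F ∈ S c) : D1 F ∈ S c := d1_mem hF

theorem D2_mem (hF : F ∈ S c) : D2 c F ∈ S c := d2_mem hF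

theorem conv_hasFDerivAt (hF : F ∈ S c) (hG : G ∈ S c) (p : ℤ) (z : ℝ × ℝ) :
    HasFDerivAt (conv hb μ ν F G p)
      ((-(conv hb μ ν (D1 F) G p z + conv hb μ ν F (D1 G) p z)) •
        (Complex.ofRealCLM.comp (ContinuousLinearMap.fst ℝ ℝ ℝ)) +
      (2 * Real.pi * Complex.I * c * p * z.1 * conv hb μ ν F G p z -
        (conv hb μ ν (D2 c F) G p z + conv hb μ ν F (D2 c G) p z)) •
        (Complex.ofRealCLM.comp (ContinuousLinearMap.snd ℝ ℝ ℝ))) z := by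
  obtain ⟨C1, hC1, h1⟩ := term_bound (hb := hb) (μ := μ) (ν := ν) (D1_mem hF) hG 0
  obtain ⟨C2, hC2, h2⟩ := term_bound (hb := hb) (μ := μ) (ν := ν) hF (D1_mem hG) 0
  obtain ⟨C3, hC3, h3⟩ := term_bound (hb := hb) (μ := μ) (ν := ν) (D2_mem hF) hG 0
  obtain ⟨C4, hC4, h4⟩ := term_bound (hb := hb) (μ := μ) (ν := ν) hF (D2_mem hG) 0
  obtain ⟨C5, hC5, h5⟩ := term_bound (hb := hb) (μ := μ) (ν := ν) hF hG 0
  simp only [pow_zero, one_mul] at h1 h2 h3 h4 h5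
  set a : ℝ := ‖(Complex.ofRealCLM.comp (ContinuousLinearMap.fst ℝ ℝ ℝ))‖
  set b : ℝ := ‖(Complex.ofRealCLM.comp (ContinuousLinearMap.snd ℝ ℝ ℝ))‖
  set M : ℝ := ‖(2 * Real.pi * Complex.I * c * p : ℂ)‖ * (|z.1| + 1)
  have hM : 0 ≤ M := by positivity
  have key := hasFDerivAt_tsum_of_isPreconnected (𝕜 := ℝ)
    (f := fun q w => term hb μ ν F G p w q)
    (u := fun q => ((C1 + C2) * a + (M * C5 + (C3 + C4)) * b) * wt q)
    (s := Metric.ball z 1) (x := z) (x₀ := z)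
    (summable_wt.mul_left _) Metric.isOpen_ball
    (convex_ball z 1).isPreconnected
    (fun q w _ => term_hasFDerivAt (hb := hb) (μ := μ) (ν := ν) hF hG p q w) ?_
    (Metric.mem_ball_self one_pos) (summable_term hF hG p z) (Metric.mem_ball_self one_pos)
  · refine key.congr_fderiv ?_
    have s1 := summable_term (hb := hb) (μ := μ) (ν := ν) (D1_mem hF) hG p z
    have s2 := summable_term (hb := hb) (μ := μ) (ν := ν) hF (D1_mem hG) p z
    have s3 := summable_term (hb := hb) (μ := μ) (ν := ν) (D2_mem hF) hG p z
    have s4 := summable_term (hb := hb) (μ := μ) (ν := ν) hF (D2_mem hG) p z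
    have s5 := summable_term (hb := hb) (μ := μ) (ν := ν) hF hG p z
    exact (((s1.hasSum.add s2.hasSum).neg.smul_const _).add
      (((s5.hasSum.mul_left _).sub (s3.hasSum.add s4.hasSum)).smul_const _)).tsum_eq
  · intro q w hw
    have hw1 : |w.1| ≤ |z.1| + 1 := by
      have h : dist w.1 z.1 ≤ 1 := by
        have h1 : dist w z < 1 := hw
        exact (le_max_left _ _).trans h1.le
      have := abs_sub_abs_le_abs_sub w.1 z.1
      rw [Real.dist_eq] at h
      linarith
    have hM' : ‖(2 * Real.pi * Complex.I * c * p * w.1 : ℂ)‖ ≤ M := by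
      rw [norm_mul, Complex.norm_real, Real.norm_eq_abs]
      exact mul_le_mul_of_nonneg_left hw1 (norm_nonneg _)
    refine (norm_add_le _ _).trans ?_
    rw [norm_smul, norm_smul, norm_neg]
    have e1 : ‖term hb μ ν (D1 F) G p w q + term hb μ ν F (D1 G) p w q‖ ≤ (C1 + C2) * wt q := by
      refine (norm_add_le _ _).trans ?_
      rw [add_mul]
      exact add_le_add (h1 p q w) (h2 p q w)
    have e2 : ‖2 * Real.pi * Complex.I * c * p * w.1 * term hb μ ν F G p w q -
        (term hb μ ν (D2 c F) G p w q + term hb μ ν F (D2 c G) p w q)‖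
        ≤ (M * C5 + (C3 + C4)) * wt q := by
      refine (norm_sub_le _ _).trans ?_
      rw [add_mul, mul_assoc M, norm_mul]
      refine add_le_add (mul_le_mul hM' (h5 p q w) (norm_nonneg _) hM) ?_
      refine (norm_add_le _ _).trans ?_
      rw [add_mul]
      exact add_le_add (h3 p q w) (h4 p q w)
    calc _ ≤ (C1 + C2) * wt q * a + (M * C5 + (C3 + C4)) * wt q * b := by
          exact add_le_add (mul_le_mul_of_nonneg_right e1 (norm_nonneg _))
            (mul_le_mul_of_nonneg_right e2 (norm_nonneg _))
      _ = _ := by ring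

theorem conv_dec (n : ℕ) : ∀ {F G : ℤ → ℝ × ℝ → ℂ}, F ∈ S c → G ∈ S c →
    Dec n (conv hb μ ν F G) := by
  induction n with
  | zero =>
    intro F G hF hG
    refine ⟨fun p => contDiff_zero.2 ?_, fun m hm N K _ => ?_⟩
    · exact continuous_iff_continuousAt.2 fun z => (conv_hasFDerivAt hF hG p z).continuousAt
    · obtain ⟨C, hC⟩ := conv_bound (hb := hb) (μ := μ) (ν := ν) hF hG N
      refine ⟨C, fun p z _ => le_trans ?_ (hC p z)⟩
      obtain rfl : m = 0 := by omega
      rw [norm_iteratedFDeriv_zero]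
      gcongr
      linarith
  | succ n ih =>
    intro F G hF hG
    refine Dec.of_fderiv ?_ (fun p z => (conv_hasFDerivAt hF hG p z).differentiableAt) ?_
    · exact (ih hF hG).mono (Nat.zero_le n)
    · have h1 := ((ih (D1_mem hF) hG).add (ih hF (D1_mem hG))).mul_smooth
        (g := fun _ => -1) contDiff_const
      have h2 := ((ih (D2_mem hF) hG).add (ih hF (D2_mem hG))).mul_smooth
        (g := fun _ => -1) contDiff_const
      have h3 := (ih hF hG).int_mul.mul_smooth
        (g := fun z => 2 * Real.pi * Complex.I * c * z.1)
        (contDiff_const.mul (Complex.ofRealCLM.contDiff.comp contDiff_fst))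
      have h4 := (h1.clm ((ContinuousLinearMap.smulRightL ℝ (ℝ × ℝ) ℂ).flip.flip
        (ContinuousLinearMap.fst ℝ ℝ ℝ))).add
        ((h3.add h2).clm ((ContinuousLinearMap.smulRightL ℝ (ℝ × ℝ) ℂ).flip.flip
        (ContinuousLinearMap.snd ℝ ℝ ℝ)))
      convert h4 using 3 with p z
      rw [(conv_hasFDerivAt hF hG p z).fderiv]
      ext
      · simp
      · simp
        ring

theorem conv_mem (hF : F ∈ S c) (hG : G ∈ S c) : conv hb μ ν F G ∈ S c := by
  refine ⟨(isRapid_iff _).2 fun n => conv_dec n hF hG, fun p x y => ?_, fun k p x y => ?_⟩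
  · refine tsum_congr fun q => ?_
    have h1 : ∀ t : ℝ, y + 1 - t = y - t + 1 := fun t => by ring
    simp only [h1, hF.2.1, hG.2.1]
  · rw [conv, conv, ← tsum_mul_left]
    refine tsum_congr fun q => ?_
    have h1 : ∀ t : ℝ, x + k - t = x - t + k := fun t => by ring
    simp only [h1, hF.2.2, hG.2.2]
    have h2 : e (c * k * p * y) = e (c * k * q * (y - hb * (q - p) * ν)) *
        e (c * k * ((p - q : ℤ) : ℝ) * (y - hb * q * ν)) := by
      rw [← e_add]
      congr 1
      push_cast
      ring
    rw [h2]
    ring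

end Product

section Algebra

/-- The algebra `𝒜^∞_ħ`: the space `S^c` with the product `⋆`. -/
structure Alg (c : ℕ) (hb μ ν : ℝ) where
  /-- The function `Φ` in `S^c`. -/
  fn : ℤ → ℝ × ℝ → ℂ
  mem : fn ∈ S c

variable {c : ℕ} {hb μ ν : ℝ}

/-- The identification of the underlying vector space with `S^c`. -/
@[reducible]
def Alg.equiv (c : ℕ) (hb μ ν : ℝ) : Alg c hb μ ν ≃ S c where
  toFun a := ⟨a.1, a.2⟩
  invFun F := ⟨F.1, F.2⟩
  left_inv _ := rfl
  right_inv _ := rfl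

noncomputable instance : AddCommGroup (Alg c hb μ ν) := (Alg.equiv c hb μ ν).addCommGroup

noncomputable instance : Module ℂ (Alg c hb μ ν) := (Alg.equiv c hb μ ν).module ℂ

theorem Alg.ext {a b : Alg c hb μ ν} (h : ∀ p z, a.1 p z = b.1 p z) : a = b := by
  have h1 : a.1 = b.1 := funext fun p => funext fun z => h p z
  cases a
  cases b
  cases h1
  rfl

theorem add_apply (a b : Alg c hb μ ν) (p : ℤ) (z : ℝ × ℝ) :
    (a + b).1 p z = a.1 p z + b.1 p z := rfl

theorem smul_apply (r : ℂ) (a : Alg c hb μ ν) (p : ℤ) (z : ℝ × ℝ) :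
    (r • a).1 p z = r * a.1 p z := rfl

noncomputable instance : Mul (Alg c hb μ ν) :=
  ⟨fun a b => ⟨conv hb μ ν a.1 b.1, conv_mem a.2 b.2⟩⟩

theorem mul_apply (a b : Alg c hb μ ν) (p : ℤ) (z : ℝ × ℝ) :
    (a * b).1 p z = ∑' q, term hb μ ν a.1 b.1 p z q := rfl

theorem one_mem : (fun (p : ℤ) (_ : ℝ × ℝ) => if p = 0 then (1 : ℂ) else 0) ∈ S c := by
  refine ⟨⟨fun p => contDiff_const, fun m N K _ => ⟨1, fun p z _ => ?_⟩⟩, ?_, ?_⟩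
  · by_cases hp : p = 0
    · cases m with
      | zero =>
        rw [norm_iteratedFDeriv_zero]
        simp only [hp, Int.cast_zero, abs_zero, if_true, norm_one, mul_one]
        exact pow_le_one₀ le_rfl zero_le_one
      | succ m =>
        rw [iteratedFDeriv_const_of_ne (Nat.succ_ne_zero m)]
        simp
    · have h0 : iteratedFDeriv ℝ m (fun _ : ℝ × ℝ => (0 : ℂ)) = 0 := iteratedFDeriv_fun_zero
      simp [hp, h0]
  · simp
  · intro k p x y
    by_cases hp : p = 0
    · simp [hp, e_zero]
    · simp [hp]

/-- The unit: the function equal to `1` at `p = 0` and to `0` at `p ≠ 0`. -/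
noncomputable instance : One (Alg c hb μ ν) := ⟨⟨_, one_mem⟩⟩

theorem one_apply (p : ℤ) (z : ℝ × ℝ) :
    (1 : Alg c hb μ ν).1 p z = if p = 0 then 1 else 0 := rfl

theorem conj_e (t : ℝ) : (starRingEnd ℂ) (e t) = e (-t) := by
  unfold e
  rw [← Complex.exp_conj, map_mul, Complex.conj_ofReal, Complex.conj_I]
  congr 1
  push_cast
  ring

theorem star_mem {F : ℤ → ℝ × ℝ → ℂ} (hF : F ∈ S c) :
    (fun p z => (starRingEnd ℂ) (F (-p) z)) ∈ S c := by
  have h1 : ∀ n, Dec n (fun p => F (-p)) := fun n =>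
    ⟨fun p => (S_dec hF n).1 (-p), fun m hm N K hK => by
      obtain ⟨C, hC⟩ := (S_dec hF n).2 m hm N K hK
      refine ⟨C, fun p z hz => ?_⟩
      simpa using hC (-p) z hz⟩
  refine ⟨(isRapid_iff _).2 fun n => (h1 n).clm (Complex.conjCLE : ℂ →L[ℝ] ℂ),
    fun p x y => ?_, fun k p x y => ?_⟩
  · simp only [hF.2.1]
  · simp only [hF.2.2, map_mul, conj_e]
    congr 2
    push_cast
    ring

/-- The involution `Φ*(x,y,p) = conj Φ(x,y,-p)`. -/
noncomputable instance : Star (Alg c hb μ ν) := ⟨fun a => ⟨_, star_mem a.2⟩⟩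

theorem star_apply (a : Alg c hb μ ν) (p : ℤ) (z : ℝ × ℝ) :
    (star a).1 p z = (starRingEnd ℂ) (a.1 (-p) z) := rfl

theorem alg_summable (a b : Alg c hb μ ν) (p : ℤ) (z : ℝ × ℝ) :
    Summable (term hb μ ν a.1 b.1 p z) := summable_term a.2 b.2 p z

theorem alg_add_mul (a b d : Alg c hb μ ν) : (a + b) * d = a * d + b * d := by
  refine Alg.ext fun p z => ?_
  rw [add_apply, mul_apply, mul_apply, mul_apply,
    ← (alg_summable a d p z).tsum_add (alg_summable b d p z)]
  refine tsum_congr fun q => ?_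
  simp only [term, add_apply]
  ring

theorem alg_mul_add (a b d : Alg c hb μ ν) : a * (b + d) = a * b + a * d := by
  refine Alg.ext fun p z => ?_
  rw [add_apply, mul_apply, mul_apply, mul_apply,
    ← (alg_summable a b p z).tsum_add (alg_summable a d p z)]
  refine tsum_congr fun q => ?_
  simp only [term, add_apply]
  ring

theorem alg_smul_mul (r : ℂ) (a b : Alg c hb μ ν) : (r • a) * b = r • (a * b) := by
  refine Alg.ext fun p z => ?_
  rw [smul_apply, mul_apply, mul_apply, ← tsum_mul_left]
  refine tsum_congr fun q => ?_
  simp only [term, smul_apply]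
  ring

theorem alg_mul_smul (r : ℂ) (a b : Alg c hb μ ν) : a * (r • b) = r • (a * b) := by
  refine Alg.ext fun p z => ?_
  rw [smul_apply, mul_apply, mul_apply, ← tsum_mul_left]
  refine tsum_congr fun q => ?_
  simp only [term, smul_apply]
  ring

theorem alg_one_mul (a : Alg c hb μ ν) : 1 * a = a := by
  refine Alg.ext fun p z => ?_
  rw [mul_apply, tsum_eq_single 0]
  · simp [term, one_apply]
  · intro q hq
    simp [term, one_apply, hq]

theorem alg_mul_one (a : Alg c hb μ ν) : a * 1 = a := by
  refine Alg.ext fun p z => ?_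
  rw [mul_apply, tsum_eq_single p]
  · simp [term, one_apply]
  · intro q hq
    have : p - q ≠ 0 := fun h => hq (by omega)
    simp [term, one_apply, this]

theorem summable_wt_prod : Summable fun x : ℤ × ℤ => wt x.2 * wt (x.1 - x.2) := by
  have h : Summable fun x : ℤ × ℤ => wt x.1 * wt x.2 :=
    summable_wt.mul_of_nonneg summable_wt wt_nonneg wt_nonneg
  let E : ℤ × ℤ ≃ ℤ × ℤ :=
    { toFun := fun x => (x.2, x.1 - x.2)
      invFun := fun x => (x.1 + x.2, x.1)
      left_inv := fun x => by ext <;> simp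
      right_inv := fun x => by ext <;> simp }
  exact E.summable_iff.2 h

theorem S_wt {F : ℤ → ℝ × ℝ → ℂ} (hF : F ∈ S c) :
    ∃ C : ℝ, 0 ≤ C ∧ ∀ p z, ‖F p z‖ ≤ C * wt p := by
  obtain ⟨C, h0, h⟩ := S_bound hF 2
  refine ⟨C, h0, fun p z => ?_⟩
  have hp : 0 < (1 + |(p : ℝ)|) ^ 2 := by positivity
  rw [wt, ← div_eq_mul_inv, le_div_iff₀ hp, mul_comm]
  exact h p z

theorem wt_le_one (p : ℤ) : wt p ≤ 1 := by
  unfold wt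
  refine inv_le_one_of_one_le₀ (one_le_pow₀ ?_)
  linarith [abs_nonneg (p : ℝ)]

theorem alg_mul_assoc (a b d : Alg c hb μ ν) : a * b * d = a * (b * d) := by
  refine Alg.ext fun p z => ?_
  let T : ℤ → ℤ → ℂ := fun q r =>
    a.1 r (z.1 - hb * (r - p) * μ, z.2 - hb * (r - p) * ν) *
    b.1 (q - r) (z.1 - hb * (q + r - p) * μ, z.2 - hb * (q + r - p) * ν) *
    d.1 (p - q) (z.1 - hb * q * μ, z.2 - hb * q * ν)
  have hT : Summable (Function.uncurry T) := by
    obtain ⟨A, hA0, hA⟩ := S_wt a.2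
    obtain ⟨B, hB0, hB⟩ := S_wt b.2
    obtain ⟨D, hD0, hD⟩ := S_wt d.2
    refine Summable.of_norm_bounded (summable_wt_prod.mul_left (A * B * D)) ?_
    rintro ⟨q, r⟩
    simp only [Function.uncurry, T, norm_mul]
    have w1 := wt_nonneg r
    have w2 := wt_nonneg (q - r)
    calc _ ≤ (A * wt r) * (B * wt (q - r)) * (D * 1) := by
          refine mul_le_mul (mul_le_mul (hA _ _) (hB _ _) (norm_nonneg _) (by positivity))
            ((hD _ _).trans ?_) (norm_nonneg _) (by positivity)
          exact mul_le_mul_of_nonneg_left (wt_le_one _) hD0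
      _ = _ := by ring
  have h1 : (a * b * d).1 p z = ∑' q, ∑' r, T q r := by
    rw [mul_apply]
    refine tsum_congr fun q => ?_
    rw [term, mul_apply, ← tsum_mul_right]
    refine tsum_congr fun r => ?_
    refine congrArg₂ HMul.hMul (congrArg₂ HMul.hMul (congrArg _ (Prod.ext ?_ ?_))
      (congrArg _ (Prod.ext ?_ ?_))) rfl <;> simp only [] <;> ring
  have h2 : (a * (b * d)).1 p z = ∑' r, ∑' q, T q r := by
    rw [mul_apply]
    refine tsum_congr fun r => ?_
    rw [term, mul_apply, ← tsum_mul_left, ← (Equiv.subRight r).tsum_eq]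
    refine tsum_congr fun q => ?_
    simp only [term, T, Equiv.subRight_apply, mul_assoc]
    have e1 : p - r - (q - r) = p - q := by ring
    rw [e1]
    refine congrArg₂ HMul.hMul rfl (congrArg₂ HMul.hMul (congrArg _ (Prod.ext ?_ ?_))
      (congrArg _ (Prod.ext ?_ ?_))) <;> push_cast <;> ring
  rw [h1, h2]
  exact hT.tsum_comm.symm

noncomputable instance : Ring (Alg c hb μ ν) where
  __ := (inferInstance : AddCommGroup (Alg c hb μ ν))
  mul_assoc := alg_mul_assoc
  one_mul := alg_one_mul
  mul_one := alg_mul_one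
  left_distrib := alg_mul_add
  right_distrib := alg_add_mul
  zero_mul a := by
    have := alg_smul_mul 0 a a
    simpa using this
  mul_zero a := by
    have := alg_mul_smul 0 a a
    simpa using this

noncomputable instance : Algebra ℂ (Alg c hb μ ν) :=
  Algebra.ofModule alg_smul_mul fun r a b => alg_mul_smul r a b

noncomputable instance : StarRing (Alg c hb μ ν) where
  star_involutive a := Alg.ext fun p z => by simp [star_apply]
  star_add a b := Alg.ext fun p z => by simp [star_apply, add_apply]
  star_mul a b := by
    refine Alg.ext fun p z => ?_
    rw [star_apply, mul_apply, mul_apply, Complex.conj_tsum, ← (Equiv.subRight p).tsum_eq]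
    refine tsum_congr fun q => ?_
    simp only [term, star_apply, map_mul, Equiv.subRight_apply]
    have e1 : -p - (q - p) = -q := by ring
    have e2 : -(p - q) = q - p := by ring
    rw [e1, e2, mul_comm]
    refine congrArg₂ HMul.hMul (congrArg _ (congrArg _ (Prod.ext ?_ ?_)))
      (congrArg _ (congrArg _ (Prod.ext ?_ ?_))) <;> push_cast <;> ring

/-- The trace `τ(φ) = ∫_0^1 ∫_𝕋 φ(x,y,0) dx dy`. -/
noncomputable def τ (a : Alg c hb μ ν) : ℂ :=
  ∫ z in Set.Icc (0 : ℝ) 1 ×ˢ Set.Icc (0 : ℝ) 1, a.1 0 z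

end Algebra

section GNS

variable {c : ℕ} {hb μ ν : ℝ}

theorem alg_continuous (a : Alg c hb μ ν) (p : ℤ) : Continuous (a.1 p) :=
  (S_contDiff a.2 p).continuous

theorem alg_integrable (a : Alg c hb μ ν) (p : ℤ) :
    MeasureTheory.IntegrableOn (a.1 p) (Set.Icc (0 : ℝ) 1 ×ˢ Set.Icc (0 : ℝ) 1) :=
  (alg_continuous a p).continuousOn.integrableOn_compact (isCompact_Icc.prod isCompact_Icc)

theorem τ_add (a b : Alg c hb μ ν) : τ (a + b) = τ a + τ b :=
  MeasureTheory.integral_add (alg_integrable a 0) (alg_integrable b 0)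

theorem τ_smul (r : ℂ) (a : Alg c hb μ ν) : τ (r • a) = r * τ a :=
  MeasureTheory.integral_const_mul r _

theorem τ_star (a : Alg c hb μ ν) : τ (star a) = (starRingEnd ℂ) (τ a) := by
  unfold τ
  rw [← integral_conj]
  simp [star_apply]

/-- The value of `a` at `(z + ħp(μ, ν), p)`. -/
noncomputable def shift (a : Alg c hb μ ν) (z : ℝ × ℝ) (p : ℤ) : ℂ :=
  a.1 p (z.1 + hb * p * μ, z.2 + hb * p * ν)

theorem star_mul_self_apply (a : Alg c hb μ ν) (z : ℝ × ℝ) :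
    (star a * a).1 0 z = ((∑' q, ‖shift a z q‖ ^ 2 : ℝ) : ℂ) := by
  rw [mul_apply, ← (Equiv.neg ℤ).tsum_eq, Complex.ofReal_tsum]
  refine tsum_congr fun q => ?_
  simp only [term, star_apply, shift, Equiv.neg_apply, neg_neg, zero_sub]
  push_cast
  rw [← Complex.conj_mul']
  have e1 : z.1 - hb * (-q - 0) * μ = z.1 + hb * q * μ := by ring
  have e2 : z.2 - hb * (-q - 0) * ν = z.2 + hb * q * ν := by ring
  have e3 : z.1 - hb * -q * μ = z.1 + hb * q * μ := by ring
  have e4 : z.2 - hb * -q * ν = z.2 + hb * q * ν := by ring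
  rw [e1, e2, e3, e4]

theorem summable_shift_sq (a : Alg c hb μ ν) (z : ℝ × ℝ) :
    Summable fun q => ‖shift a z q‖ ^ 2 := by
  obtain ⟨A, hA0, hA⟩ := S_wt a.2
  refine Summable.of_nonneg_of_le (fun q => by positivity) (fun q => ?_)
    (summable_wt.mul_left (A * A))
  have w := wt_nonneg q
  calc ‖shift a z q‖ ^ 2 = ‖shift a z q‖ * ‖shift a z q‖ := sq _
    _ ≤ (A * wt q) * (A * 1) := by
        refine mul_le_mul (hA _ _) ((hA _ _).trans ?_) (norm_nonneg _) (by positivity)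
        exact mul_le_mul_of_nonneg_left (wt_le_one _) hA0
    _ = _ := by ring

theorem τ_star_mul_self (a : Alg c hb μ ν) : τ (star a * a) =
    ((∫ z in Set.Icc (0 : ℝ) 1 ×ˢ Set.Icc (0 : ℝ) 1, ∑' q, ‖shift a z q‖ ^ 2 : ℝ) : ℂ) := by
  unfold τ
  rw [← integral_complex_ofReal]
  simp only [star_mul_self_apply]

theorem continuous_density (a : Alg c hb μ ν) :
    Continuous fun z : ℝ × ℝ => ∑' q, ‖shift a z q‖ ^ 2 := by
  have h := Complex.continuous_re.comp (alg_continuous (star a * a) 0)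
  refine h.congr fun z => ?_
  simp [star_mul_self_apply]

theorem τ_definite (a : Alg c hb μ ν) (h : τ (star a * a) = 0) : a = 0 := by
  rw [τ_star_mul_self, Complex.ofReal_eq_zero] at h
  have hn : ∀ z : ℝ × ℝ, 0 ≤ ∑' q, ‖shift a z q‖ ^ 2 := fun z =>
    tsum_nonneg fun q => by positivity
  have hc := continuous_density a
  rw [MeasureTheory.setIntegral_eq_zero_iff_of_nonneg_ae (Filter.Eventually.of_forall hn)
    (hc.continuousOn.integrableOn_compact (isCompact_Icc.prod isCompact_Icc))] at h
  have h2 := MeasureTheory.Measure.eqOn_of_ae_eq h hc.continuousOn continuousOn_const (by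
    rw [interior_prod_eq, interior_Icc, closure_prod_eq, closure_Ioo (zero_ne_one)])
  refine Alg.ext fun p w => ?_
  have hz : ((Int.fract (w.1 - hb * p * μ), Int.fract (w.2 - hb * p * ν)) : ℝ × ℝ) ∈
      Set.Icc (0 : ℝ) 1 ×ˢ Set.Icc (0 : ℝ) 1 :=
    ⟨⟨Int.fract_nonneg _, (Int.fract_lt_one _).le⟩, ⟨Int.fract_nonneg _, (Int.fract_lt_one _).le⟩⟩
  have h3 := h2 hz
  have h4 := ((hasSum_zero_iff_of_nonneg (fun q => by positivity)).1
    ((summable_shift_sq a _).hasSum_iff.2 h3))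
  have h5 : shift a (Int.fract (w.1 - hb * p * μ), Int.fract (w.2 - hb * p * ν)) p = 0 := by
    simpa using congrFun h4 p
  have h6 : ‖a.1 p w‖ = 0 := by
    rw [← norm_eq_zero, shift] at h5
    rw [← h5, show w = (w.1, w.2) from rfl, S_norm_fract a.2]
    conv_rhs => rw [S_norm_fract a.2]
    have e1 : Int.fract (Int.fract (w.1 - hb * p * μ) + hb * p * μ) = Int.fract w.1 := by
      rw [Int.fract_eq_fract]
      exact ⟨-⌊w.1 - hb * p * μ⌋, by rw [Int.fract]; push_cast; ring⟩
    have e2 : Int.fract (Int.fract (w.2 - hb * p * ν) + hb * p * ν) = Int.fract w.2 := by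
      rw [Int.fract_eq_fract]
      exact ⟨-⌊w.2 - hb * p * ν⌋, by rw [Int.fract]; push_cast; ring⟩
    rw [e1, e2]
  exact norm_eq_zero.1 h6

/-- The inner product `⟨a, b⟩ = τ(a* b)`. -/
@[reducible]
noncomputable def core : InnerProductSpace.Core ℂ (Alg c hb μ ν) where
  inner a b := τ (star a * b)
  conj_inner_symm a b := by
    rw [← τ_star, star_mul, star_star]
  re_inner_nonneg a := by
    rw [τ_star_mul_self]
    change 0 ≤ (Complex.ofReal _).re
    rw [Complex.ofReal_re]
    exact MeasureTheory.integral_nonneg fun z => tsum_nonneg fun q => by positivity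
  add_left a b d := by rw [star_add, add_mul, τ_add]
  smul_left a b r := by
    have : star (r • a) = (starRingEnd ℂ) r • star a :=
      Alg.ext fun p z => by simp [star_apply, smul_apply]
    rw [this, alg_smul_mul, τ_smul]
  definite := τ_definite

noncomputable instance : NormedAddCommGroup (Alg c hb μ ν) := core.toNormedAddCommGroup

noncomputable instance : InnerProductSpace ℂ (Alg c hb μ ν) := InnerProductSpace.ofCore core.toCore

theorem alg_norm_sq (a : Alg c hb μ ν) : ‖a‖ ^ 2 =
    ∫ z in Set.Icc (0 : ℝ) 1 ×ˢ Set.Icc (0 : ℝ) 1, ∑' q, ‖shift a z q‖ ^ 2 := by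
  rw [InnerProductSpace.norm_sq_eq_re_inner (𝕜 := ℂ)]
  change (τ (star a * a)).re = _
  rw [τ_star_mul_self, Complex.ofReal_re]

theorem young {A B : ℤ → ℝ} (hA0 : ∀ q, 0 ≤ A q) (hA : Summable A)
    (hB : Summable fun q => B q ^ 2) (hAB : ∀ p, Summable fun q => A q * B (p - q)) :
    (Summable fun p => ∑' q, A q * B (p - q) ^ 2) ∧
    ∑' p, ∑' q, A q * B (p - q) ^ 2 = (∑' q, A q) * ∑' q, B q ^ 2 ∧
    ∀ p, (∑' q, A q * B (p - q)) ^ 2 ≤ (∑' q, A q) * ∑' q, A q * B (p - q) ^ 2 := by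
  have h : Summable fun x : ℤ × ℤ => A x.1 * B x.2 ^ 2 :=
    hA.mul_of_nonneg hB hA0 fun q => sq_nonneg _
  let E : ℤ × ℤ ≃ ℤ × ℤ :=
    { toFun := fun x => (x.2, x.1 - x.2)
      invFun := fun x => (x.1 + x.2, x.1)
      left_inv := fun x => by ext <;> simp
      right_inv := fun x => by ext <;> simp }
  have h2 : Summable fun x : ℤ × ℤ => A x.2 * B (x.1 - x.2) ^ 2 := E.summable_iff.2 h
  have h2' : Summable (Function.uncurry fun p q => A q * B (p - q) ^ 2) := h2
  refine ⟨h2.prod, ?_, fun p => ?_⟩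
  · calc ∑' p, ∑' q, A q * B (p - q) ^ 2 = ∑' x : ℤ × ℤ, A x.2 * B (x.1 - x.2) ^ 2 :=
          (h2.tsum_prod).symm
      _ = ∑' x : ℤ × ℤ, A x.1 * B x.2 ^ 2 := E.tsum_eq (fun x : ℤ × ℤ => A x.1 * B x.2 ^ 2)
      _ = _ := (hA.tsum_mul_tsum hB h).symm
  · have h3 : Summable fun q => A q * B (p - q) ^ 2 := h2.prod_factor p
    refine le_of_tendsto' ((hAB p).hasSum.pow 2) fun s => ?_
    calc (∑ q ∈ s, A q * B (p - q)) ^ 2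
        ≤ (∑ q ∈ s, A q) * ∑ q ∈ s, A q * B (p - q) ^ 2 :=
          Finset.sum_sq_le_sum_mul_sum_of_sq_le_mul s (fun q _ => hA0 q)
            (fun q _ => mul_nonneg (hA0 q) (sq_nonneg _)) fun q _ => (by ring : _ = _).le
      _ ≤ _ := by
          refine mul_le_mul (hA.sum_le_tsum s fun q _ => hA0 q)
            (h3.sum_le_tsum s fun q _ => mul_nonneg (hA0 q) (sq_nonneg _)) ?_
            (tsum_nonneg hA0)
          exact Finset.sum_nonneg fun q _ => mul_nonneg (hA0 q) (sq_nonneg _)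

theorem density_mul_le (a : Alg c hb μ ν) : ∃ M : ℝ, 0 ≤ M ∧ ∀ (b : Alg c hb μ ν) (z : ℝ × ℝ),
    ∑' q, ‖shift (a * b) z q‖ ^ 2 ≤ M ^ 2 * ∑' q, ‖shift b z q‖ ^ 2 := by
  obtain ⟨A, hA0, hA⟩ := S_wt a.2
  have hw0 : ∀ q, 0 ≤ A * wt q := fun q => mul_nonneg hA0 (wt_nonneg q)
  have hws : Summable fun q => A * wt q := summable_wt.mul_left A
  refine ⟨∑' q, A * wt q, tsum_nonneg hw0, fun b z => ?_⟩
  have hb0 := summable_shift_sq b z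
  obtain ⟨B, hB0, hB⟩ := S_wt b.2
  have hAB : ∀ p, Summable fun q => A * wt q * ‖shift b z (p - q)‖ := fun p => by
    refine Summable.of_nonneg_of_le (fun q => mul_nonneg (hw0 q) (norm_nonneg _)) (fun q => ?_)
      (hws.mul_right B)
    refine mul_le_mul_of_nonneg_left ((hB _ _).trans ?_) (hw0 q)
    exact mul_le_of_le_one_right hB0 (wt_le_one _)
  obtain ⟨y1, y2, y3⟩ := young hw0 hws hb0 hAB
  have key : ∀ p, ‖shift (a * b) z p‖ ≤ ∑' q, A * wt q * ‖shift b z (p - q)‖ := by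
    intro p
    rw [shift, mul_apply]
    refine tsum_of_norm_bounded (hAB p).hasSum fun q => ?_
    rw [term, norm_mul]
    refine mul_le_mul (hA _ _) (le_of_eq ?_) (norm_nonneg _) (hw0 q)
    rw [shift]
    refine congrArg _ (congrArg _ (Prod.ext ?_ ?_)) <;> push_cast <;> ring
  have key2 : ∀ p, ‖shift (a * b) z p‖ ^ 2 ≤
      (∑' q, A * wt q) * ∑' q, A * wt q * ‖shift b z (p - q)‖ ^ 2 := fun p =>
    (pow_le_pow_left₀ (norm_nonneg _) (key p) 2).trans (y3 p)
  calc ∑' q, ‖shift (a * b) z q‖ ^ 2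
      ≤ ∑' p, (∑' q, A * wt q) * ∑' q, A * wt q * ‖shift b z (p - q)‖ ^ 2 :=
        (summable_shift_sq (a * b) z).tsum_le_tsum key2 (y1.mul_left _)
    _ = _ := by
        rw [tsum_mul_left, y2]
        ring

theorem exists_mul_bound (a : Alg c hb μ ν) : ∃ M : ℝ, ∀ b : Alg c hb μ ν,
    ‖a * b‖ ≤ M * ‖b‖ := by
  obtain ⟨M, hM0, hM⟩ := density_mul_le a
  refine ⟨M, fun b => ?_⟩
  refine le_of_sq_le_sq ?_ (by positivity)
  rw [mul_pow, alg_norm_sq, alg_norm_sq, ← MeasureTheory.integral_const_mul]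
  have hi : ∀ d : Alg c hb μ ν, MeasureTheory.IntegrableOn
      (fun z : ℝ × ℝ => ∑' q, ‖shift d z q‖ ^ 2) (Set.Icc (0 : ℝ) 1 ×ˢ Set.Icc (0 : ℝ) 1) :=
    fun d => (continuous_density d).continuousOn.integrableOn_compact
      (isCompact_Icc.prod isCompact_Icc)
  exact MeasureTheory.integral_mono (hi _) ((hi b).const_mul _) (hM b)

/-- The Hilbert space `L²(𝒜^∞_ħ, τ)`, the completion of the algebra for `⟨a, b⟩ = τ(a* b)`. -/
abbrev L2 (c : ℕ) (hb μ ν : ℝ) : Type := UniformSpace.Completion (Alg c hb μ ν)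

/-- Left multiplication as a bounded operator on the algebra with its `L²`-norm. -/
noncomputable def leftMul (a : Alg c hb μ ν) : Alg c hb μ ν →L[ℂ] Alg c hb μ ν :=
  LinearMap.mkContinuousOfExistsBound (LinearMap.mulLeft ℂ a) (exists_mul_bound a)

/-- The representation of the algebra on `L²(𝒜^∞_ħ, τ)` by left multiplication. -/
noncomputable def lam (a : Alg c hb μ ν) : L2 c hb μ ν →L[ℂ] L2 c hb μ ν := (leftMul a).completion

theorem lam_coe (a b : Alg c hb μ ν) : lam a (b : L2 c hb μ ν) = ((a * b : Alg c hb μ ν) : L2 c hb μ ν) :=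
  ContinuousLinearMap.completion_apply_coe (leftMul a) b

end GNS

section Dirac

variable {c : ℕ} {hb μ ν : ℝ}

/-- `d₁(f) = -∂f/∂x`. -/
noncomputable def d1 : Alg c hb μ ν →ₗ[ℂ] Alg c hb μ ν where
  toFun a := ⟨fun p z => -fderiv ℝ (a.1 p) z (1, 0), d1_mem a.2⟩
  map_add' a b := Alg.ext fun p z => by
    have h : fderiv ℝ ((a + b).1 p) z = fderiv ℝ (a.1 p) z + fderiv ℝ (b.1 p) z :=
      fderiv_add (S_diff a.2 p z) (S_diff b.2 p z)
    rw [add_apply]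
    simp only [h, _root_.add_apply]
    ring
  map_smul' r a := Alg.ext fun p z => by
    have h : fderiv ℝ ((r • a).1 p) z = r • fderiv ℝ (a.1 p) z :=
      fderiv_const_smul (S_diff a.2 p z) r
    rw [smul_apply]
    simp [h]

/-- `d₂(f) = 2πicpx f - ∂f/∂y`. -/
noncomputable def d2 : Alg c hb μ ν →ₗ[ℂ] Alg c hb μ ν where
  toFun a := ⟨fun p z => 2 * Real.pi * Complex.I * c * p * z.1 * a.1 p z
    - fderiv ℝ (a.1 p) z (0, 1), d2_mem a.2⟩
  map_add' a b := Alg.ext fun p z => by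
    have h : fderiv ℝ ((a + b).1 p) z = fderiv ℝ (a.1 p) z + fderiv ℝ (b.1 p) z :=
      fderiv_add (S_diff a.2 p z) (S_diff b.2 p z)
    rw [add_apply]
    simp only [h, add_apply, _root_.add_apply]
    ring
  map_smul' r a := Alg.ext fun p z => by
    have h : fderiv ℝ ((r • a).1 p) z = r • fderiv ℝ (a.1 p) z :=
      fderiv_const_smul (S_diff a.2 p z) r
    rw [smul_apply]
    simp only [h, smul_apply, _root_.smul_apply, smul_eq_mul, RingHom.id_apply]
    ring

/-- `d₃(f) = 2πipcα f`. -/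
noncomputable def d3 (α : ℝ) : Alg c hb μ ν →ₗ[ℂ] Alg c hb μ ν where
  toFun a := ⟨fun p z => 2 * Real.pi * Complex.I * p * c * α * a.1 p z, d3_mem a.2 α⟩
  map_add' a b := Alg.ext fun p z => by
    rw [add_apply]
    simp only [add_apply]
    ring
  map_smul' r a := Alg.ext fun p z => by
    rw [smul_apply]
    simp only [smul_apply, RingHom.id_apply]
    ring

/-- The derivations `d₁, d₂, d₃`. -/
noncomputable def d (α : ℝ) : Fin 3 → (Alg c hb μ ν →ₗ[ℂ] Alg c hb μ ν) := ![d1, d2, d3 α]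

theorem d_mul (α : ℝ) (j : Fin 3) (a b : Alg c hb μ ν) :
    d α j (a * b) = d α j a * b + a * d α j b := by
  have hab (p : ℤ) (z : ℝ × ℝ) := (conv_hasFDerivAt (hb := hb) (μ := μ) (ν := ν) a.2 b.2 p z).fderiv
  refine Alg.ext fun p z => ?_
  fin_cases j
  · change -fderiv ℝ (conv hb μ ν a.1 b.1 p) z (1, 0) =
      conv hb μ ν (D1 a.1) b.1 p z + conv hb μ ν a.1 (D1 b.1) p z
    rw [hab]
    simp
  · change 2 * Real.pi * Complex.I * c * p * z.1 * conv hb μ ν a.1 b.1 p z -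
        fderiv ℝ (conv hb μ ν a.1 b.1 p) z (0, 1) =
      conv hb μ ν (D2 c a.1) b.1 p z + conv hb μ ν a.1 (D2 c b.1) p z
    rw [hab]
    simp
  · change 2 * Real.pi * Complex.I * p * c * α * (a * b).1 p z =
      (d3 α a * b).1 p z + (a * d3 α b).1 p z
    rw [mul_apply, mul_apply, mul_apply,
      ← (alg_summable _ b p z).tsum_add (alg_summable a _ p z), ← tsum_mul_left]
    refine tsum_congr fun q => ?_
    simp only [term, d3, LinearMap.coe_mk, AddHom.coe_mk]
    push_cast
    ring

/-- `δ_j = i d_j`. -/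
noncomputable def δ (α : ℝ) (j : Fin 3) : Alg c hb μ ν →ₗ[ℂ] Alg c hb μ ν := Complex.I • d α j

theorem δ_mul (α : ℝ) (j : Fin 3) (a b : Alg c hb μ ν) :
    δ α j (a * b) = δ α j a * b + a * δ α j b := by
  simp only [δ, LinearMap.smul_apply, d_mul, smul_add, alg_smul_mul, alg_mul_smul]

/-- The matrices `σ₁, σ₂, σ₃`. -/
noncomputable def σ : Fin 3 → Matrix (Fin 2) (Fin 2) ℂ :=
  ![!![1, 0; 0, -1], !![0, -1; -1, 0], !![0, Complex.I; -Complex.I, 0]]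

/-- The Hilbert space `L²(𝒜^∞_ħ, τ) ⊗ ℂ²`. -/
abbrev H (c : ℕ) (hb μ ν : ℝ) : Type := PiLp 2 fun _ : Fin 2 => L2 c hb μ ν

/-- The bounded operator `a ⊗ s` on `L²(𝒜^∞_ħ, τ) ⊗ ℂ²`, for `a` in the algebra and
`s ∈ M₂(ℂ)`. -/
noncomputable def tens (a : Alg c hb μ ν) (s : Matrix (Fin 2) (Fin 2) ℂ) :
    H c hb μ ν →L[ℂ] H c hb μ ν :=
  ((PiLp.continuousLinearEquiv 2 ℂ fun _ : Fin 2 => L2 c hb μ ν).symm :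
      (Fin 2 → L2 c hb μ ν) →L[ℂ] H c hb μ ν).comp
    (ContinuousLinearMap.pi fun i => ∑ l, s i l • (lam a).comp (PiLp.proj 2 _ l))

theorem tens_apply (a : Alg c hb μ ν) (s : Matrix (Fin 2) (Fin 2) ℂ) (ξ : H c hb μ ν) (i : Fin 2) :
    tens a s ξ i = ∑ l, s i l • lam a (ξ l) := by
  simp [tens]

/-- The inclusion of the dense subspace `S^c ⊗ ℂ²` in the Hilbert space. -/
noncomputable def smoothEmb : (Fin 2 → Alg c hb μ ν) →ₗ[ℂ] H c hb μ ν where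
  toFun ψ := WithLp.toLp 2 fun i => (ψ i : L2 c hb μ ν)
  map_add' ψ φ := by
    ext i
    simp [UniformSpace.Completion.coe_add]
  map_smul' r ψ := by
    ext i
    simp [UniformSpace.Completion.coe_smul]

theorem smoothEmb_apply (ψ : Fin 2 → Alg c hb μ ν) (i : Fin 2) :
    smoothEmb ψ i = (ψ i : L2 c hb μ ν) := rfl

theorem smoothEmb_injective :
    Function.Injective (smoothEmb : (Fin 2 → Alg c hb μ ν) →ₗ[ℂ] H c hb μ ν) := by
  intro ψ φ h
  ext1 i
  have := congrArg (fun ξ : H c hb μ ν => ξ i) h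
  exact UniformSpace.Completion.coe_injective _ this

theorem smoothEmb_denseRange :
    DenseRange (smoothEmb : (Fin 2 → Alg c hb μ ν) →ₗ[ℂ] H c hb μ ν) := by
  have h1 : DenseRange fun (ψ : Fin 2 → Alg c hb μ ν) (i : Fin 2) => (ψ i : L2 c hb μ ν) :=
    DenseRange.piMap fun _ => UniformSpace.Completion.denseRange_coe
  exact (PiLp.continuousLinearEquiv 2 ℂ fun _ : Fin 2 => L2 c hb μ ν).symm.surjective.denseRange.comp
    h1 (PiLp.continuousLinearEquiv 2 ℂ fun _ : Fin 2 => L2 c hb μ ν).symm.continuous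

/-- `∑_j δ_j ⊗ σ_j` on `S^c ⊗ ℂ²`. -/
noncomputable def smoothDirac (α : ℝ) : (Fin 2 → Alg c hb μ ν) →ₗ[ℂ] (Fin 2 → Alg c hb μ ν) :=
  LinearMap.pi fun i => ∑ j, ∑ l, σ j i l • (δ α j).comp (LinearMap.proj l)

/-- The Dirac operator `D = ∑_j δ_j ⊗ σ_j`, an unbounded operator on the Hilbert space with the
dense domain `S^c ⊗ ℂ²`. Its domain is invariant under the algebra, and the commutators `[D, a]`
are bounded, so they are the same for `D` and for all its self-adjoint extensions. -/
noncomputable def dirac (c : ℕ) (hb μ ν α : ℝ) : H c hb μ ν →ₗ.[ℂ] H c hb μ ν where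
  domain := LinearMap.range (smoothEmb : (Fin 2 → Alg c hb μ ν) →ₗ[ℂ] H c hb μ ν)
  toFun := (smoothEmb : (Fin 2 → Alg c hb μ ν) →ₗ[ℂ] H c hb μ ν) ∘ₗ smoothDirac α ∘ₗ
    ((LinearEquiv.ofInjective (smoothEmb : (Fin 2 → Alg c hb μ ν) →ₗ[ℂ] H c hb μ ν) smoothEmb_injective).symm :
      LinearMap.range (smoothEmb : (Fin 2 → Alg c hb μ ν) →ₗ[ℂ] H c hb μ ν) →ₗ[ℂ] (Fin 2 → Alg c hb μ ν))

/-- `T` is the bounded operator `[D, A]`: the bounded operator `A` preserves the domain of `D`, and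
`T` extends `D A - A D`. -/
def IsCommutator {E : Type*} [NormedAddCommGroup E] [NormedSpace ℂ E] (D : E →ₗ.[ℂ] E)
    (A T : E →L[ℂ] E) : Prop :=
  ∀ ψ : D.domain, ∃ h : A ψ ∈ D.domain, T ψ = D ⟨A ψ, h⟩ - A (D ψ)

theorem dirac_apply (α : ℝ) (ψ : Fin 2 → Alg c hb μ ν)
    (h : smoothEmb ψ ∈ (dirac c hb μ ν α).domain) :
    dirac c hb μ ν α ⟨smoothEmb ψ, h⟩ = smoothEmb (smoothDirac α ψ) := by
  have h1 : (LinearEquiv.ofInjective (smoothEmb : (Fin 2 → Alg c hb μ ν) →ₗ[ℂ] H c hb μ ν) smoothEmb_injective).symm ⟨smoothEmb ψ, ψ, rfl⟩ = ψ :=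
    (LinearEquiv.symm_apply_eq _).2 rfl
  change smoothEmb (smoothDirac α
    ((LinearEquiv.ofInjective (smoothEmb : (Fin 2 → Alg c hb μ ν) →ₗ[ℂ] H c hb μ ν) smoothEmb_injective).symm ⟨smoothEmb ψ, ψ, rfl⟩)) = _
  rw [h1]

theorem tens_smoothEmb (a : Alg c hb μ ν) (s : Matrix (Fin 2) (Fin 2) ℂ)
    (ψ : Fin 2 → Alg c hb μ ν) :
    tens a s (smoothEmb ψ) = smoothEmb fun i => ∑ l, s i l • (a * ψ l) := by
  ext i
  rw [tens_apply]
  simp only [smoothEmb_apply, lam_coe, Fin.sum_univ_two, UniformSpace.Completion.coe_add,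
    UniformSpace.Completion.coe_smul]

theorem isCommutator_iff (α : ℝ) (a : Alg c hb μ ν) (T : H c hb μ ν →L[ℂ] H c hb μ ν) :
    IsCommutator (dirac c hb μ ν α) (tens a 1) T ↔ ∀ ψ, T (smoothEmb ψ) =
      smoothEmb (smoothDirac α (fun i => a * ψ i)) - tens a 1 (smoothEmb (smoothDirac α ψ)) := by
  have h1 : ∀ ψ : Fin 2 → Alg c hb μ ν, tens a 1 (smoothEmb ψ) = smoothEmb fun i => a * ψ i := by
    intro ψ
    rw [tens_smoothEmb]
    congr 1
    ext1 i
    simp [Matrix.one_apply]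
  have h2 : ∀ (ψ : Fin 2 → Alg c hb μ ν)
      (h : tens a 1 (smoothEmb ψ) ∈ (dirac c hb μ ν α).domain),
      dirac c hb μ ν α ⟨tens a 1 (smoothEmb ψ), h⟩ = smoothEmb (smoothDirac α fun i => a * ψ i) := by
    intro ψ
    rw [h1]
    exact dirac_apply α _
  constructor
  · intro hT ψ
    have hm : smoothEmb ψ ∈ (dirac c hb μ ν α).domain := LinearMap.mem_range_self _ ψ
    obtain ⟨h, hh⟩ := hT ⟨smoothEmb ψ, hm⟩
    rw [h2, dirac_apply] at hh
    exact hh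
  · rintro hT ⟨ξ, hξ⟩
    obtain ⟨ψ, rfl⟩ : ∃ ψ, smoothEmb ψ = ξ := LinearMap.mem_range.1 hξ
    refine ⟨?_, ?_⟩
    · rw [h1]
      exact LinearMap.mem_range_self _ _
    · rw [h2, dirac_apply]
      exact hT ψ

theorem tens_sum_spec (α : ℝ) (a : Alg c hb μ ν) (ψ : Fin 2 → Alg c hb μ ν) :
    (∑ j, tens (δ α j a) (σ j)) (smoothEmb ψ) =
      smoothEmb (smoothDirac α (fun i => a * ψ i)) - tens a 1 (smoothEmb (smoothDirac α ψ)) := by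
  simp only [sum_apply, tens_smoothEmb, ← map_sum, ← map_sub]
  congr 1
  ext1 i
  simp only [smoothDirac, LinearMap.pi_apply, Finset.sum_apply, Pi.sub_apply,
    LinearMap.sum_apply, LinearMap.smul_apply, LinearMap.comp_apply, LinearMap.proj_apply, δ_mul,
    Matrix.one_apply, ite_smul, one_smul, zero_smul, Finset.sum_ite_eq, Finset.mem_univ, if_true,
    Finset.mul_sum, alg_mul_smul, ← Finset.sum_sub_distrib, smul_add, add_sub_cancel_right]

theorem existsUnique_comm (α : ℝ) (a : Alg c hb μ ν) :
    ∃! T : H c hb μ ν →L[ℂ] H c hb μ ν, IsCommutator (dirac c hb μ ν α) (tens a 1) T := by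
  simp only [isCommutator_iff]
  refine ⟨∑ j, tens (δ α j a) (σ j), tens_sum_spec α a, fun T hT => ?_⟩
  refine DFunLike.ext' (smoothEmb_denseRange.equalizer T.continuous
    (ContinuousLinearMap.continuous _) (funext fun ψ => ?_))
  simp only [Function.comp_apply, hT, tens_sum_spec]

theorem tens_add (a b : Alg c hb μ ν) (s : Matrix (Fin 2) (Fin 2) ℂ) :
    tens (a + b) s = tens a s + tens b s := by
  refine DFunLike.ext' (smoothEmb_denseRange.equalizer (ContinuousLinearMap.continuous _)
    (ContinuousLinearMap.continuous _) (funext fun ψ => ?_))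
  simp only [Function.comp_apply, _root_.add_apply, tens_smoothEmb, ← map_add, add_mul]
  congr 1
  ext1 i
  simp [Finset.sum_add_distrib]

theorem tens_smul (r : ℂ) (a : Alg c hb μ ν) (s : Matrix (Fin 2) (Fin 2) ℂ) :
    tens (r • a) s = r • tens a s := by
  refine DFunLike.ext' (smoothEmb_denseRange.equalizer (ContinuousLinearMap.continuous _)
    (ContinuousLinearMap.continuous _) (funext fun ψ => ?_))
  simp only [Function.comp_apply, _root_.smul_apply, tens_smoothEmb, ← map_smul, alg_smul_mul]
  congr 1
  ext1 i
  simp [smul_comm r]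

theorem tens_mul (a b : Alg c hb μ ν) : tens (a * b) 1 = tens a 1 * tens b 1 := by
  refine DFunLike.ext' (smoothEmb_denseRange.equalizer (ContinuousLinearMap.continuous _)
    (ContinuousLinearMap.continuous _) (funext fun ψ => ?_))
  change tens (a * b) 1 (smoothEmb ψ) = tens a 1 (tens b 1 (smoothEmb ψ))
  simp only [tens_smoothEmb]
  congr 1
  ext1 i
  simp [Matrix.one_apply, mul_assoc]

theorem tens_one : tens (1 : Alg c hb μ ν) 1 = 1 := by
  refine DFunLike.ext' (smoothEmb_denseRange.equalizer (ContinuousLinearMap.continuous _)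
    (ContinuousLinearMap.continuous _) (funext fun ψ => ?_))
  simp only [Function.comp_apply, one_apply_eq_self, tens_smoothEmb]
  congr 1
  ext1 i
  simp [Matrix.one_apply]

/-- The representation `a ↦ a ⊗ 1` of the algebra on the Hilbert space. -/
noncomputable def rep (c : ℕ) (hb μ ν : ℝ) :
    Alg c hb μ ν →ₐ[ℂ] (H c hb μ ν →L[ℂ] H c hb μ ν) :=
  AlgHom.ofLinearMap { toFun := fun a => tens a 1
                       map_add' := fun a b => tens_add a b 1
                       map_smul' := fun r a => tens_smul r a 1 } tens_one tens_mul

/-- `a ↦ [D, a]`. -/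
noncomputable def comm (c : ℕ) (hb μ ν α : ℝ) :
    Alg c hb μ ν →ₗ[ℂ] (H c hb μ ν →L[ℂ] H c hb μ ν) where
  toFun a := (existsUnique_comm α a).choose
  map_add' a b := by
    have h (a : Alg c hb μ ν) := (isCommutator_iff α a _).1 (existsUnique_comm α a).choose_spec.1
    refine ((existsUnique_comm α (a + b)).choose_spec.2 _ ((isCommutator_iff _ _ _).2
      fun ψ => ?_)).symm
    have e1 : (fun i => (a + b) * ψ i) = (fun i => a * ψ i) + fun i => b * ψ i := by
      ext1 i
      exact add_mul _ _ _
    rw [_root_.add_apply, h, h, tens_add, _root_.add_apply, e1, map_add, map_add]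
    abel
  map_smul' r a := by
    have h := (isCommutator_iff α a _).1 (existsUnique_comm α a).choose_spec.1
    refine ((existsUnique_comm α (r • a)).choose_spec.2 _ ((isCommutator_iff _ _ _).2
      fun ψ => ?_)).symm
    have e1 : (fun i => (r • a) * ψ i) = r • fun i => a * ψ i := by
      ext1 i
      exact alg_smul_mul _ _ _
    rw [RingHom.id_apply, _root_.smul_apply, h, tens_smul, _root_.smul_apply, e1, map_smul,
      map_smul, smul_sub]

theorem comm_one (α : ℝ) : comm c hb μ ν α 1 = 0 := by
  refine ((existsUnique_comm α 1).choose_spec.2 _ ((isCommutator_iff _ _ _).2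
    fun ψ => ?_)).symm
  rw [tens_one]
  simp

end Dirac

section Forms

open scoped TensorProduct

/-- `A / ℂ1`. -/
abbrev Abar (A : Type) [Ring A] [Algebra ℂ A] : Type := A ⧸ Submodule.span ℂ {(1 : A)}

/-- The universal differential forms `Ω^•(A) = A ⊗ T(A/ℂ1)` of a unital algebra. The tensor
`a₀ ⊗ [a₁] ⋯ [a_k]` is the form `a₀ δa₁ ⋯ δa_k`. -/
abbrev Univ (A : Type) [Ring A] [Algebra ℂ A] : Type := A ⊗[ℂ] TensorAlgebra ℂ (Abar A)

variable {A B : Type} [Ring A] [Algebra ℂ A] [Ring B] [Algebra ℂ B]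

/-- The space `Ω^k(A)` of universal `k`-forms: the span of the forms `a₀ δa₁ ⋯ δa_k`. -/
noncomputable def UForm (A : Type) [Ring A] [Algebra ℂ A] (k : ℕ) : Submodule ℂ (Univ A) :=
  Submodule.span ℂ {ω | ∃ (a₀ : A) (a : Fin k → A), ω = a₀ ⊗ₜ
    (List.ofFn fun i => TensorAlgebra.ι ℂ (Submodule.Quotient.mk (a i) : Abar A)).prod}

/-- The differential `δ(a₀ δa₁ ⋯ δa_k) = δa₀ δa₁ ⋯ δa_k`. -/
noncomputable def univD (A : Type) [Ring A] [Algebra ℂ A] : Univ A →ₗ[ℂ] Univ A :=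
  TensorProduct.mk ℂ A (TensorAlgebra ℂ (Abar A)) 1 ∘ₗ
    TensorProduct.lift (LinearMap.mul ℂ (TensorAlgebra ℂ (Abar A)) ∘ₗ TensorAlgebra.ι ℂ ∘ₗ
      (Submodule.span ℂ {(1 : A)}).mkQ)

theorem univD_tmul (a : A) (t : TensorAlgebra ℂ (Abar A)) :
    univD A (a ⊗ₜ t) = 1 ⊗ₜ (TensorAlgebra.ι ℂ (Submodule.Quotient.mk a : Abar A) * t) := rfl

theorem univD_mem {k : ℕ} {ω : Univ A} (hω : ω ∈ UForm A k) : univD A ω ∈ UForm A (k + 1) := by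
  have h : UForm A k ≤ (UForm A (k + 1)).comap (univD A) := by
    refine Submodule.span_le.2 ?_
    rintro _ ⟨a₀, a, rfl⟩
    refine Submodule.subset_span ⟨1, Fin.cons a₀ a, ?_⟩
    rw [univD_tmul, List.ofFn_succ, List.prod_cons]
    rfl
  exact h hω

theorem univD_univD (ω : Univ A) : univD A (univD A ω) = 0 := by
  have h0 : (Submodule.Quotient.mk (1 : A) : Abar A) = 0 :=
    (Submodule.Quotient.mk_eq_zero _).2 (Submodule.mem_span_singleton_self 1)
  induction ω using TensorProduct.induction_on with
  | zero => simp
  | tmul a t => rw [univD_tmul, univD_tmul, h0, map_zero, zero_mul, TensorProduct.tmul_zero]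
  | add x y hx hy => rw [map_add, map_add, hx, hy, add_zero]

/-- The representation `π(a₀ δa₁ ⋯ δa_k) = ρ(a₀) ∂(a₁) ⋯ ∂(a_k)` of the universal forms. For a
spectral triple, `∂(a) = [D, a]`. -/
noncomputable def univRep (ρ : A →ₐ[ℂ] B) (D : A →ₗ[ℂ] B) (hD : D 1 = 0) : Univ A →ₗ[ℂ] B :=
  TensorProduct.lift ((LinearMap.mul ℂ B).compl₁₂ ρ.toLinearMap
    (TensorAlgebra.lift ℂ ((Submodule.span ℂ {(1 : A)}).liftQ D (by
      rw [Submodule.span_le, Set.singleton_subset_iff]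
      exact hD))).toLinearMap)

theorem univRep_tmul (ρ : A →ₐ[ℂ] B) (D : A →ₗ[ℂ] B) (hD : D 1 = 0) (a₀ : A) {k : ℕ}
    (a : Fin k → A) :
    univRep ρ D hD (a₀ ⊗ₜ
      (List.ofFn fun i => TensorAlgebra.ι ℂ (Submodule.Quotient.mk (a i) : Abar A)).prod) =
    ρ a₀ * (List.ofFn fun i => D (a i)).prod := by
  simp only [univRep, TensorProduct.lift.tmul, LinearMap.compl₁₂_apply, LinearMap.mul_apply',
    AlgHom.toLinearMap_apply, map_list_prod, List.map_ofFn]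
  congr 3
  ext1 i
  simp [Submodule.liftQ_apply]

variable (π : Univ A →ₗ[ℂ] B)

/-- `J_k`, the kernel of `π` on `Ω^k(A)`. -/
noncomputable def J (k : ℕ) : Submodule ℂ (Univ A) := UForm A k ⊓ LinearMap.ker π

/-- `π(Ω^k(A))`. -/
noncomputable def piForm (k : ℕ) : Submodule ℂ B := (UForm A k).map π

/-- `π(δ J_{k-1})`, with `J_{-1} = 0`. -/
noncomputable def junk : ℕ → Submodule ℂ B
  | 0 => ⊥
  | k + 1 => ((J π k).map (univD A)).map π

/-- The space of Connes forms `Ω_D^k(A) = π(Ω^k(A)) / π(δ J_{k-1})`. -/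
abbrev OmegaD (k : ℕ) : Type := piForm π k ⧸ (junk π k).comap (piForm π k).subtype

/-- The class in `Ω_D^k(A)` of an operator in `π(Ω^k(A))`. -/
noncomputable def cls (k : ℕ) (T : B) (hT : T ∈ piForm π k) : OmegaD π k :=
  Submodule.Quotient.mk ⟨T, hT⟩

/-- The quotient map `π_D : Ω^k(A) → Ω_D^k(A)`. -/
noncomputable def piD (k : ℕ) : UForm A k →ₗ[ℂ] OmegaD π k :=
  ((junk π k).comap (piForm π k).subtype).mkQ ∘ₗ
    π.restrict fun _ hω => Submodule.mem_map_of_mem hω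

theorem piD_apply (k : ℕ) (ω : UForm A k) :
    piD π k ω = cls π k (π ω) (Submodule.mem_map_of_mem ω.2) := rfl

theorem piD_eq_zero_iff (k : ℕ) (ω : UForm A k) : piD π k ω = 0 ↔ π ω ∈ junk π k :=
  Submodule.Quotient.mk_eq_zero _

theorem piD_surjective (k : ℕ) : Function.Surjective (piD π k) := by
  intro x
  obtain ⟨⟨_, ω, hω, rfl⟩, rfl⟩ := Submodule.Quotient.mk_surjective _ x
  exact ⟨⟨ω, hω⟩, rfl⟩

/-- `δ : Ω^k(A) → Ω^{k+1}(A)`. -/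
noncomputable def univDk (A : Type) [Ring A] [Algebra ℂ A] (k : ℕ) :
    UForm A k →ₗ[ℂ] UForm A (k + 1) :=
  (univD A).restrict fun _ hω => univD_mem hω

theorem ker_piD_le (k : ℕ) :
    LinearMap.ker (piD π k) ≤ LinearMap.ker (piD π (k + 1) ∘ₗ univDk A k) := by
  rintro ⟨ω, hω⟩ h
  rw [LinearMap.mem_ker, piD_eq_zero_iff] at h
  rw [LinearMap.mem_ker, LinearMap.comp_apply, piD_eq_zero_iff]
  change π (univD A ω) ∈ ((J π k).map (univD A)).map π
  refine Submodule.mem_map_of_mem ?_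
  cases k with
  | zero =>
    have h' : π ω = 0 := h
    exact Submodule.mem_map_of_mem ⟨hω, h'⟩
  | succ k =>
    obtain ⟨_, ⟨η, hη, rfl⟩, h2⟩ := h
    have h3 : univD A ω = univD A (ω - univD A η) := by
      rw [map_sub, univD_univD, sub_zero]
    rw [h3]
    refine Submodule.mem_map_of_mem ⟨Submodule.sub_mem _ hω (univD_mem hη.1), ?_⟩
    change π (ω - univD A η) = 0
    rw [map_sub, h2, sub_self]

/-- The differential `d̃ : Ω_D^k(A) → Ω_D^{k+1}(A)` induced by `δ`. -/
noncomputable def dTilde (k : ℕ) : OmegaD π k →ₗ[ℂ] OmegaD π (k + 1) :=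
  (LinearMap.ker (piD π k)).liftQ (piD π (k + 1) ∘ₗ univDk A k) (ker_piD_le π k) ∘ₗ
    ((piD π k).quotKerEquivOfSurjective (piD_surjective π k)).symm.toLinearMap

/-- `d̃ ∘ π_D = π_D ∘ δ`. -/
theorem dTilde_piD (k : ℕ) (ω : UForm A k) :
    dTilde π k (piD π k ω) = piD π (k + 1) (univDk A k ω) := by
  have h : ((piD π k).quotKerEquivOfSurjective (piD_surjective π k)).symm (piD π k ω) =
      Submodule.Quotient.mk ω := (LinearEquiv.symm_apply_eq _).2 rfl
  change (LinearMap.ker (piD π k)).liftQ (piD π (k + 1) ∘ₗ univDk A k) (ker_piD_le π k)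
    (((piD π k).quotKerEquivOfSurjective (piD_surjective π k)).symm (piD π k ω)) = _
  rw [h]
  rfl

end Forms

/-- The representation of the universal forms of `𝒜^∞_ħ` given by the spectral triple:
`π(a₀ δa₁ ⋯ δa_k) = a₀ [D, a₁] ⋯ [D, a_k]`. -/
noncomputable def πQ (c : ℕ) (hb μ ν α : ℝ) :
    Univ (Alg c hb μ ν) →ₗ[ℂ] (H c hb μ ν →L[ℂ] H c hb μ ν) :=
  univRep (rep c hb μ ν) (comm c hb μ ν α) (comm_one α)

/-- `d̃(T) = T'` for `d̃ : Ω_D^k(𝒜^∞_ħ) → Ω_D^{k+1}(𝒜^∞_ħ)`: the operators `T` and `T'` belong to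
`π(Ω^k)` and to `π(Ω^{k+1})`, and `d̃` maps the class of `T` to the class of `T'`. -/
def DTildeEq (c : ℕ) (hb μ ν α : ℝ) (k : ℕ) (T T' : H c hb μ ν →L[ℂ] H c hb μ ν) : Prop :=
  ∃ (h : T ∈ piForm (πQ c hb μ ν α) k) (h' : T' ∈ piForm (πQ c hb μ ν α) (k + 1)),
    dTilde (πQ c hb μ ν α) k (cls _ k T h) = cls _ (k + 1) T' h'

end QHM

namespace QHM

/-! ### Operator calculus: commutation relations of the derivations and Clifford relations -/

section Operators

variable {c : ℕ} {hb μ ν : ℝ}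

/-! Indices 0, 1, 2 stand for 1, 2, 3 in the statement. Since `[D, y] = ∑_k δ_k(y) ⊗ σ_k`, the form
`x δy` is represented by `∑_k a_k ⊗ σ_k` with `a_k = x δ_k(y)`; call `(a_k)` its symbol. Its
differential is represented by `[D, x][D, y] = ∑_{j,k} δ_j(x) δ_k(y) ⊗ σ_j σ_k`. The matrices square
to 1 and anticommute, so this splits in two.

The diagonal terms give `f ⊗ 1` with `f = ∑_k δ_k(x) δ_k(y)`. For `j < k` the coefficient of `σ_j
σ_k` is `δ_j(x) δ_k(y) - δ_k(x) δ_j(y) = δ_j(a_k) - δ_k(a_j) - x [δ_j, δ_k](y)`. The only nonzero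
commutator is the Heisenberg relation `[δ_0, δ_1] = -(i/α) δ_2`, which contributes `(i/α) a_2` to
`σ_0 σ_1`. Thus the off-diagonal part, `twoForm α a`, depends only on the symbol and linearly so;
this is `πQ_univD_mulDiff`, and it is where the term `(i/α) a ⊗ σ_0 σ_1` comes from.

The diagonal part is invisible in the quotient, because every `f ⊗ 1` is junk (`tens_one_mem_junk`).
With `u = e(x)`, the form `f u⁻¹ δu + f u δ(u⁻¹)` has symbol zero, while its differential is
represented by `-2(2π)² f ⊗ 1`. Hence `d̃` sends the class of `oneForm a` to that of `twoForm α a`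
whenever `a` is a symbol (`IsSymbol.dTildeEq`).

It remains to see that each `a ⊗ σ_j` comes from a symbol. For `j = 0, 1` the forms `a u⁻¹ δu` with
`u = e(x)` or `u = e(y)` suffice (`isSymbol_character`). For `j = 2` elements of nonzero degree in
`p` are needed, since `δ_2` is the scalar `-2πncα` in degree `n`. A pair of sections in degree 1 and
a pair in degree -1 with `x₁y₁ + x₂y₂ = 1` replace a unitary (`exists_partition`): the form `a x₁
δy₁ + a x₂ δy₂` has last component `2πcα a`, and its other components are removed by the first two
cases (`isSymbol_two`). -/

theorem clm_ext_smoothEmb {S T : H c hb μ ν →L[ℂ] H c hb μ ν}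
    (h : ∀ ψ, S (smoothEmb ψ) = T (smoothEmb ψ)) : S = T :=
  DFunLike.ext' (smoothEmb_denseRange.equalizer (ContinuousLinearMap.continuous _)
    (ContinuousLinearMap.continuous _) (funext h))

theorem tens_neg_right (a : Alg c hb μ ν) (s : Matrix (Fin 2) (Fin 2) ℂ) :
    tens a (-s) = -tens a s := by
  ext ξ i
  simp [tens_apply]

theorem tens_neg (a : Alg c hb μ ν) (s : Matrix (Fin 2) (Fin 2) ℂ) :
    tens (-a) s = -tens a s :=
  (AddMonoidHom.mk' (fun a : Alg c hb μ ν => tens a s) fun a b => tens_add a b s).map_neg a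

theorem tens_sub (a b : Alg c hb μ ν) (s : Matrix (Fin 2) (Fin 2) ℂ) :
    tens (a - b) s = tens a s - tens b s := by
  rw [sub_eq_add_neg, tens_add, tens_neg, ← sub_eq_add_neg]

theorem tens_zero (s : Matrix (Fin 2) (Fin 2) ℂ) : tens (0 : Alg c hb μ ν) s = 0 :=
  (AddMonoidHom.mk' (fun a : Alg c hb μ ν => tens a s) fun a b => tens_add a b s).map_zero

theorem tens_mul_tens (a b : Alg c hb μ ν) (s t : Matrix (Fin 2) (Fin 2) ℂ) :
    tens a s * tens b t = tens (a * b) (s * t) := by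
  refine clm_ext_smoothEmb fun ψ => ?_
  change tens a s (tens b t (smoothEmb ψ)) = _
  simp only [tens_smoothEmb]
  congr 1
  ext1 i
  simp only [Fin.sum_univ_two, Matrix.mul_apply, mul_add, alg_mul_smul, smul_add, add_smul,
    smul_smul, mul_assoc]
  abel

/-- `comm` is defined by choice from an existence and uniqueness statement; the Leibniz rule,
through `tens_sum_spec`, shows that this sum has the defining property. -/
theorem comm_apply (α : ℝ) (a : Alg c hb μ ν) :
    comm c hb μ ν α a = ∑ j, tens (δ α j a) (σ j) :=
  ((existsUnique_comm α a).choose_spec.2 _ ((isCommutator_iff _ _ _).2 (tens_sum_spec α a))).symm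

theorem d1_apply (a : Alg c hb μ ν) (p : ℤ) (z : ℝ × ℝ) :
    (d1 a).1 p z = -fderiv ℝ (a.1 p) z (1, 0) := rfl

theorem d2_apply (a : Alg c hb μ ν) (p : ℤ) (z : ℝ × ℝ) :
    (d2 a).1 p z = 2 * Real.pi * Complex.I * c * p * z.1 * a.1 p z
      - fderiv ℝ (a.1 p) z (0, 1) := rfl

theorem d3_apply (α : ℝ) (a : Alg c hb μ ν) (p : ℤ) (z : ℝ × ℝ) :
    (d3 α a).1 p z = 2 * Real.pi * Complex.I * p * c * α * a.1 p z := rfl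

theorem sub_apply (a b : Alg c hb μ ν) (p : ℤ) (z : ℝ × ℝ) :
    (a - b).1 p z = a.1 p z - b.1 p z := rfl

/-- In each degree `p` the operator `d3` is multiplication by a constant, so it commutes with
differentiation in `x` and `y`. -/
theorem d1_d3 (α : ℝ) (a : Alg c hb μ ν) : d1 (d3 α a) = d3 α (d1 a) := by
  refine Alg.ext fun p z => ?_
  rw [d1_apply, d3_apply, d1_apply]
  have h : fderiv ℝ ((d3 α a).1 p) z =
      (2 * Real.pi * Complex.I * p * c * α : ℂ) • fderiv ℝ (a.1 p) z :=
    fderiv_const_smul (S_diff a.2 p z) (2 * Real.pi * Complex.I * p * c * α : ℂ)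
  rw [h]
  simp

theorem d2_d3 (α : ℝ) (a : Alg c hb μ ν) : d2 (d3 α a) = d3 α (d2 a) := by
  refine Alg.ext fun p z => ?_
  rw [d2_apply, d3_apply, d3_apply, d2_apply]
  have h : fderiv ℝ ((d3 α a).1 p) z =
      (2 * Real.pi * Complex.I * p * c * α : ℂ) • fderiv ℝ (a.1 p) z :=
    fderiv_const_smul (S_diff a.2 p z) (2 * Real.pi * Complex.I * p * c * α : ℂ)
  rw [h]
  simp
  ring

/-- The derivative of a partial derivative. -/
theorem hasFDerivAt_fderiv_apply {F : ℤ → ℝ × ℝ → ℂ} (hF : F ∈ S c) (p : ℤ) (z v : ℝ × ℝ) :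
    HasFDerivAt (fun w => fderiv ℝ (F p) w v)
      ((ContinuousLinearMap.apply ℝ ℂ v).comp (fderiv ℝ (fderiv ℝ (F p)) z)) z := by
  have h : Differentiable ℝ (fderiv ℝ (F p)) :=
    ((S_contDiff hF p).fderiv_right (m := 1) (by norm_cast)).differentiable (by norm_num)
  exact (ContinuousLinearMap.apply ℝ ℂ v).hasFDerivAt.comp z (h z).hasFDerivAt

/-- The Heisenberg relation. By symmetry of second derivatives the mixed partials cancel, and
differentiating the coefficient `2πicpx` of `d2` in `x` leaves `-2πicp a`, which is `-α⁻¹ d₃(a)`. -/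
theorem d1_d2 (α : ℝ) (hα : α ≠ 0) (a : Alg c hb μ ν) :
    d1 (d2 a) = d2 (d1 a) - (α : ℂ)⁻¹ • d3 α a := by
  refine Alg.ext fun p z => ?_
  rw [sub_apply, smul_apply, d1_apply, d2_apply, d3_apply, d1_apply]
  have e1 : HasFDerivAt (fun w : ℝ × ℝ => 2 * Real.pi * Complex.I * c * p * (w.1 : ℂ))
      ((2 * Real.pi * Complex.I * c * p : ℂ) •
        (Complex.ofRealCLM.comp (ContinuousLinearMap.fst ℝ ℝ ℝ))) z :=
    (Complex.ofRealCLM.comp (ContinuousLinearMap.fst ℝ ℝ ℝ)).hasFDerivAt.const_mul _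
  have h2 : fderiv ℝ ((d2 a).1 p) z = _ :=
    ((e1.mul (S_diff a.2 p z).hasFDerivAt).sub
      (hasFDerivAt_fderiv_apply a.2 p z (0, 1))).fderiv
  have h1 : fderiv ℝ ((d1 a).1 p) z = _ := (hasFDerivAt_fderiv_apply a.2 p z (1, 0)).neg.fderiv
  have hs : IsSymmSndFDerivAt ℝ (a.1 p) z :=
    (S_contDiff a.2 p).contDiffAt.isSymmSndFDerivAt (by
      rw [minSmoothness_of_isRCLikeNormedField]
      exact WithTop.coe_le_coe.2 (le_top : (2 : ℕ∞) ≤ ⊤))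
  have hs' := hs (1, 0) (0, 1)
  have hα' : (α : ℂ) ≠ 0 := by exact_mod_cast hα
  rw [h1, h2]
  simp [hs']
  field_simp
  ring

/-- Here `i² [d₁, d₂] = α⁻¹ d₃`, and `d₃ = -i δ_2` yields the coefficient `-i/α`. -/
theorem δ_zero_one (α : ℝ) (hα : α ≠ 0) (a : Alg c hb μ ν) :
    δ α 0 (δ α 1 a) = δ α 1 (δ α 0 a) - (Complex.I / α) • δ α 2 a := by
  change Complex.I • d1 (Complex.I • d2 a) = Complex.I • d2 (Complex.I • d1 a) -
    (Complex.I / α) • Complex.I • d3 α a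
  rw [map_smul, map_smul, d1_d2 α hα]
  module

theorem δ_zero_two (α : ℝ) (a : Alg c hb μ ν) : δ α 0 (δ α 2 a) = δ α 2 (δ α 0 a) := by
  change Complex.I • d1 (Complex.I • d3 α a) = Complex.I • d3 α (Complex.I • d1 a)
  rw [map_smul, map_smul, d1_d3]

theorem δ_one_two (α : ℝ) (a : Alg c hb μ ν) : δ α 1 (δ α 2 a) = δ α 2 (δ α 1 a) := by
  change Complex.I • d2 (Complex.I • d3 α a) = Complex.I • d3 α (Complex.I • d2 a)
  rw [map_smul, map_smul, d2_d3]

/-- With the three anticommutation rules below, this reduces each product `σ_j σ_k` to 1 or, up to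
sign, to a product with `j < k`. -/
theorem σ_mul_self (j : Fin 3) : σ j * σ j = 1 := by
  fin_cases j <;> ext i k <;> fin_cases i <;> fin_cases k <;> simp [σ]

theorem σ_one_zero : σ 1 * σ 0 = -(σ 0 * σ 1) := by
  ext i k
  fin_cases i <;> fin_cases k <;> simp [σ]

theorem σ_two_zero : σ 2 * σ 0 = -(σ 0 * σ 2) := by
  ext i k
  fin_cases i <;> fin_cases k <;> simp [σ]

theorem σ_two_one : σ 2 * σ 1 = -(σ 1 * σ 2) := by
  ext i k
  fin_cases i <;> fin_cases k <;> simp [σ]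

end Operators

open scoped TensorProduct

/-! ### Symbols of universal one-forms and the operators of their differentials -/

section Curvature

variable {c : ℕ} {hb μ ν : ℝ}

/-- The operator `∑_k a_k ⊗ σ_k`. -/
noncomputable def oneForm (a : Fin 3 → Alg c hb μ ν) : H c hb μ ν →L[ℂ] H c hb μ ν :=
  tens (a 0) (σ 0) + tens (a 1) (σ 1) + tens (a 2) (σ 2)

/-- The two-form that represents the differential of `∑_k a_k ⊗ σ_k`. -/
noncomputable def twoForm (α : ℝ) (a : Fin 3 → Alg c hb μ ν) : H c hb μ ν →L[ℂ] H c hb μ ν :=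
  tens (δ α 0 (a 1) - δ α 1 (a 0) + (Complex.I / (α : ℂ)) • a 2) (σ 0 * σ 1) +
    tens (δ α 0 (a 2) - δ α 2 (a 0)) (σ 0 * σ 2) + tens (δ α 1 (a 2) - δ α 2 (a 1)) (σ 1 * σ 2)

/-- Linearity of `oneForm` and `twoForm` carries the computation for a single `x δy` over to linear
combinations of such forms. -/
theorem oneForm_add (a b : Fin 3 → Alg c hb μ ν) : oneForm (a + b) = oneForm a + oneForm b := by
  simp only [oneForm, Pi.add_apply, tens_add]
  abel

theorem oneForm_smul (r : ℂ) (a : Fin 3 → Alg c hb μ ν) : oneForm (r • a) = r • oneForm a := by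
  simp only [oneForm, Pi.smul_apply, tens_smul, smul_add]

theorem twoForm_add (α : ℝ) (a b : Fin 3 → Alg c hb μ ν) :
    twoForm α (a + b) = twoForm α a + twoForm α b := by
  simp only [twoForm, Pi.add_apply, map_add, smul_add, tens_add, tens_sub]
  abel

theorem twoForm_smul (α : ℝ) (r : ℂ) (a : Fin 3 → Alg c hb μ ν) :
    twoForm α (r • a) = r • twoForm α a := by
  simp only [twoForm, Pi.smul_apply, map_smul, smul_comm _ r, ← smul_sub, ← smul_add, tens_smul]
  rw [smul_add, smul_add]

/-- The form `x δy` for `x`, `y` in the algebra. -/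
noncomputable def mulDiff {A : Type} [Ring A] [Algebra ℂ A] (x y : A) : Univ A :=
  x ⊗ₜ TensorAlgebra.ι ℂ (Submodule.Quotient.mk y : Abar A)

theorem mulDiff_mem {A : Type} [Ring A] [Algebra ℂ A] (x y : A) : mulDiff x y ∈ UForm A 1 :=
  Submodule.subset_span ⟨x, fun _ => y, by simp [mulDiff]⟩

theorem univRep_mulDiff {A B : Type} [Ring A] [Algebra ℂ A] [Ring B] [Algebra ℂ B]
    (ρ : A →ₐ[ℂ] B) (D : A →ₗ[ℂ] B) (hD : D 1 = 0) (x y : A) :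
    univRep ρ D hD (mulDiff x y) = ρ x * D y := by
  have h := univRep_tmul ρ D hD x (k := 1) fun _ => y
  simpa [mulDiff] using h

theorem univRep_univD_mulDiff {A B : Type} [Ring A] [Algebra ℂ A] [Ring B] [Algebra ℂ B]
    (ρ : A →ₐ[ℂ] B) (D : A →ₗ[ℂ] B) (hD : D 1 = 0) (x y : A) :
    univRep ρ D hD (univD A (mulDiff x y)) = D x * D y := by
  have h := univRep_tmul ρ D hD 1 (k := 2) ![x, y]
  simpa [mulDiff, univD_tmul] using h

theorem πQ_mulDiff (α : ℝ) (x y : Alg c hb μ ν) :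
    πQ c hb μ ν α (mulDiff x y) = oneForm fun k => x * δ α k y := by
  rw [πQ, univRep_mulDiff, comm_apply]
  change tens x 1 * _ = _
  simp only [Fin.sum_univ_three, mul_add, tens_mul_tens, one_mul, oneForm]

/-- Expand `[D, x][D, y]` with the Clifford relations. The squares give the term at the matrix 1. In
the antisymmetric part, the Leibniz rule trades `δ_j(x) δ_k(y)` for `δ_j(x δ_k(y)) - x δ_j(δ_k(y))`,
and the second derivatives cancel except for the commutator of `δ_0` and `δ_1`. -/
theorem πQ_univD_mulDiff (α : ℝ) (hα : α ≠ 0) (x y : Alg c hb μ ν) :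
    πQ c hb μ ν α (univD _ (mulDiff x y)) =
      twoForm α (fun k => x * δ α k y) + tens (∑ k, δ α k x * δ α k y) 1 := by
  rw [πQ, univRep_univD_mulDiff, comm_apply, comm_apply]
  simp only [Fin.sum_univ_three, mul_add, add_mul, tens_mul_tens, twoForm, σ_mul_self, σ_one_zero,
    σ_two_zero, σ_two_one, tens_neg_right, δ_mul, δ_zero_one α hα, δ_zero_two, δ_one_two, tens_add,
    tens_sub, mul_sub, alg_mul_smul]
  abel

/-- The family `a` is the symbol of a universal one-form, and the operator of its differential is
`twoForm α a` up to an operator `f ⊗ 1`. -/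
def IsSymbol (α : ℝ) (a : Fin 3 → Alg c hb μ ν) (f : Alg c hb μ ν) : Prop :=
  ∃ ω ∈ UForm (Alg c hb μ ν) 1, πQ c hb μ ν α ω = oneForm a ∧
    πQ c hb μ ν α (univD _ ω) = twoForm α a + tens f 1

theorem IsSymbol.add {α : ℝ} {a b : Fin 3 → Alg c hb μ ν} {f g : Alg c hb μ ν}
    (ha : IsSymbol α a f) (h : IsSymbol α b g) : IsSymbol α (a + b) (f + g) := by
  obtain ⟨ω, hω, h1, h2⟩ := ha
  obtain ⟨η, hη, h3, h4⟩ := h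
  refine ⟨ω + η, add_mem hω hη, ?_, ?_⟩
  · rw [map_add, h1, h3, oneForm_add]
  · rw [map_add, map_add, h2, h4, twoForm_add, tens_add]
    abel

theorem IsSymbol.smul {α : ℝ} {a : Fin 3 → Alg c hb μ ν} {f : Alg c hb μ ν}
    (ha : IsSymbol α a f) (r : ℂ) : IsSymbol α (r • a) (r • f) := by
  obtain ⟨ω, hω, h1, h2⟩ := ha
  refine ⟨r • ω, Submodule.smul_mem _ r hω, ?_, ?_⟩
  · rw [map_smul, h1, oneForm_smul]
  · rw [map_smul, map_smul, h2, twoForm_smul, tens_smul, smul_add]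

theorem isSymbol_mul {α : ℝ} (hα : α ≠ 0) (x y : Alg c hb μ ν) :
    IsSymbol α (fun k => x * δ α k y) (∑ k, δ α k x * δ α k y) :=
  ⟨mulDiff x y, mulDiff_mem x y, πQ_mulDiff α x y, πQ_univD_mulDiff α hα x y⟩

/-- If `a` is the symbol of a one-form and `f ⊗ 1` is junk for every `f`, then
`d̃(∑_k a_k ⊗ σ_k)` is the class of `twoForm α a`. -/
theorem IsSymbol.dTildeEq {α : ℝ} {a : Fin 3 → Alg c hb μ ν} {f : Alg c hb μ ν}
    (ha : IsSymbol α a f) (hf : tens f 1 ∈ junk (πQ c hb μ ν α) 2) :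
    DTildeEq c hb μ ν α 1 (oneForm a) (twoForm α a) := by
  obtain ⟨ω, hω, h1, h2⟩ := ha
  have hd : πQ c hb μ ν α (univD _ ω) ∈ piForm (πQ c hb μ ν α) 2 :=
    Submodule.mem_map_of_mem (univD_mem hω)
  -- Junk lies in `π(Ω²)`. So `twoForm α a`, the difference of `π(δω)` and `f ⊗ 1`, lies there too.
  have hj : tens f 1 ∈ piForm (πQ c hb μ ν α) 2 := by
    obtain ⟨_, ⟨η, hη, rfl⟩, h3⟩ := hf
    rw [← h3]
    exact Submodule.mem_map_of_mem (univD_mem hη.1)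
  have h' : twoForm α a ∈ piForm (πQ c hb μ ν α) 2 := by
    have := sub_mem hd hj
    rwa [h2, add_sub_cancel_right] at this
  have h : oneForm a ∈ piForm (πQ c hb μ ν α) 1 := h1 ▸ Submodule.mem_map_of_mem hω
  refine ⟨h, h', ?_⟩
  -- The differential of the class can be computed on the representative `ω`; the outcome differs
  -- from `twoForm α a` by `f ⊗ 1`, which is zero in the quotient.
  have e1 : cls (πQ c hb μ ν α) 1 (oneForm a) h = piD (πQ c hb μ ν α) 1 ⟨ω, hω⟩ := by
    rw [piD_apply]
    simp only [h1]
  rw [e1, dTilde_piD, piD_apply]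
  refine (Submodule.Quotient.eq _).2 ?_
  change πQ c hb μ ν α (univD _ ω) - twoForm α a ∈ junk (πQ c hb μ ν α) 2
  rwa [h2, add_sub_cancel_left]

/-- The form `δa` is `1 δa`, whose operator is `[D, a]`; no junk has to be removed in this degree.
-/
theorem dTildeEq_zero (α : ℝ) (a : Alg c hb μ ν) :
    DTildeEq c hb μ ν α 0 (tens a 1) (∑ j, tens (δ α j a) (σ j)) := by
  have hω : a ⊗ₜ[ℂ] (1 : TensorAlgebra ℂ (Abar (Alg c hb μ ν))) ∈ UForm (Alg c hb μ ν) 0 :=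
    Submodule.subset_span ⟨a, Fin.elim0, by simp⟩
  have h1 : πQ c hb μ ν α (a ⊗ₜ 1) = tens a 1 := by
    have h := univRep_tmul (rep c hb μ ν) (comm c hb μ ν α) (comm_one α) a (k := 0) Fin.elim0
    simp only [List.ofFn_zero, List.prod_nil, mul_one] at h
    exact h
  have h2 : πQ c hb μ ν α (univD _ (a ⊗ₜ 1)) = ∑ j, tens (δ α j a) (σ j) := by
    have h := univRep_mulDiff (rep c hb μ ν) (comm c hb μ ν α) (comm_one α) 1 a
    rw [map_one, one_mul, comm_apply] at h
    rw [univD_tmul, mul_one]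
    exact h
  refine ⟨h1 ▸ Submodule.mem_map_of_mem hω, h2 ▸ Submodule.mem_map_of_mem (univD_mem hω), ?_⟩
  have e1 := dTilde_piD (πQ c hb μ ν α) 0 ⟨_, hω⟩
  rw [piD_apply, piD_apply] at e1
  simp only [h1] at e1
  refine e1.trans ?_
  simp only [univDk, LinearMap.restrict_apply, h2]

end Curvature

/-! ### Explicit elements of the algebra: torus characters and a partition of unity in degrees 1 and
-1 -/

section Elements

variable {c : ℕ} {hb μ ν : ℝ}

/-- `g` is a smooth function on `ℝ × 𝕋` with the quasi-periodicity of the functions `Φ(·, ·, n)`,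
`Φ ∈ S^c`. -/
structure IsSection (c : ℕ) (n : ℤ) (g : ℝ × ℝ → ℂ) : Prop where
  contDiff : ContDiff ℝ (⊤ : ℕ∞) g
  add_one : ∀ x y, g (x, y + 1) = g (x, y)
  add_int : ∀ (k : ℤ) x y, g (x + k, y) = e (c * k * n * y) * g (x, y)

/-- With a single nonzero degree, decay in `p` is automatic and only bounds on compact sets in the
fixed degree `n` remain. -/
theorem IsSection.mem {n : ℤ} {g : ℝ × ℝ → ℂ} (hg : IsSection c n g) :
    (fun (p : ℤ) (z : ℝ × ℝ) => if p = n then g z else 0) ∈ S c := by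
  refine ⟨⟨fun p => ?_, fun m N K hK => ?_⟩, fun p x y => ?_, fun k p x y => ?_⟩
  · by_cases hp : p = n
    · simpa only [hp, if_true] using hg.contDiff
    · simpa only [hp, if_false] using contDiff_const
  · obtain ⟨B, hB⟩ := hK.exists_bound_of_continuousOn
      (hg.contDiff.continuous_iteratedFDeriv (m := m) (by exact_mod_cast le_top)).continuousOn
    -- The maximum with 0 keeps the bound nonnegative, as the degrees `p ≠ n` require even if `K` is
    -- empty and `B` negative.
    refine ⟨|(n : ℝ)| ^ N * max B 0, fun p z hz => ?_⟩
    by_cases hp : p = n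
    · simp only [hp, if_true]
      exact mul_le_mul_of_nonneg_left ((hB z hz).trans (le_max_left _ _)) (by positivity)
    · have h0 : iteratedFDeriv ℝ m (fun _ : ℝ × ℝ => (0 : ℂ)) = 0 := iteratedFDeriv_fun_zero
      simp only [hp, if_false, h0, Pi.zero_apply, norm_zero, mul_zero]
      positivity
  · simp only [hg.add_one]
  · by_cases hp : p = n
    · simp only [hp, if_true, hg.add_int]
    · simp only [hp, if_false, mul_zero]

/-- The element of the algebra with the single component `g` in degree `n`. -/
noncomputable def IsSection.toAlg (hb μ ν : ℝ) {n : ℤ} {g : ℝ × ℝ → ℂ} (hg : IsSection c n g) :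
    Alg c hb μ ν := ⟨_, hg.mem⟩

theorem IsSection.toAlg_apply {n : ℤ} {g : ℝ × ℝ → ℂ} (hg : IsSection c n g) (p : ℤ)
    (z : ℝ × ℝ) : (hg.toAlg hb μ ν).1 p z = if p = n then g z else 0 := rfl

/-- Only the term `q = n` of the convolution survives, and it needs `p - n = m`. -/
theorem IsSection.toAlg_mul_apply {n m : ℤ} {g h : ℝ × ℝ → ℂ} (hg : IsSection c n g)
    (hh : IsSection c m h) (p : ℤ) (z : ℝ × ℝ) :
    (hg.toAlg hb μ ν * hh.toAlg hb μ ν).1 p z =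
      if p = n + m then g (z.1 - hb * (n - p) * μ, z.2 - hb * (n - p) * ν) *
        h (z.1 - hb * n * μ, z.2 - hb * n * ν) else 0 := by
  rw [mul_apply, tsum_eq_single n]
  · simp only [term, toAlg_apply, if_true]
    by_cases hp : p = n + m
    · simp [hp]
    · have : p - n ≠ m := fun h => hp (by omega)
      simp [hp, this]
  · intro q hq
    simp [term, toAlg_apply, hq]

/-- The sign comes from `i · 2πi = -2π`. A nonzero eigenvalue requires a nonzero degree `n`. -/
theorem IsSection.δ_two {n : ℤ} {g : ℝ × ℝ → ℂ} (hg : IsSection c n g) (α : ℝ) :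
    δ α 2 (hg.toAlg hb μ ν) = (-(2 * Real.pi * n * c * α) : ℂ) • hg.toAlg hb μ ν := by
  refine Alg.ext fun p z => ?_
  change Complex.I * (d3 α (hg.toAlg hb μ ν)).1 p z = _ * (hg.toAlg hb μ ν).1 p z
  rw [d3_apply, toAlg_apply]
  by_cases hp : p = n
  · simp only [hp, if_true]
    linear_combination (2 * Real.pi * n * c * α * g z) * Complex.I_mul_I
  · simp [hp]

theorem e_int (k : ℤ) : e k = 1 := by
  unfold e
  rw [Complex.exp_eq_one_iff]
  exact ⟨k, by push_cast; ring⟩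

theorem contDiff_e : ContDiff ℝ (⊤ : ℕ∞) e := by
  unfold e
  refine Complex.contDiff_exp.comp ?_
  exact (Complex.ofRealCLM.contDiff.comp (contDiff_const.mul contDiff_id)).mul contDiff_const

/-- In degree zero the twist `e(ckny)` is trivial, so integer frequencies suffice. -/
theorem isSection_character (c : ℕ) (k l : ℤ) :
    IsSection c 0 fun z => e (k * z.1 + l * z.2) where
  contDiff := contDiff_e.comp ((contDiff_const.mul contDiff_fst).add
    (contDiff_const.mul contDiff_snd))
  add_one x y := by
    have : (k : ℝ) * x + l * (y + 1) = k * x + l * y + l := by ring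
    simp only [this, e_add, e_int, mul_one]
  add_int m x y := by
    have : (k : ℝ) * (x + m) + l * y = k * x + l * y + ((k * m : ℤ) : ℝ) := by
      push_cast
      ring
    simp only [this, e_add _ ((k * m : ℤ) : ℝ), e_int, mul_one]
    simp [e_zero]

/-- The character `e(kx + ly)` of the torus, an element of degree zero of the algebra. -/
noncomputable def character (c : ℕ) (hb μ ν : ℝ) (k l : ℤ) : Alg c hb μ ν :=
  (isSection_character c k l).toAlg hb μ ν

/-- In degree zero the translations by `ħ(μ, ν)` disappear and the product is pointwise. -/
theorem character_mul_neg (k l : ℤ) :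
    character c hb μ ν k l * character c hb μ ν (-k) (-l) = 1 := by
  refine Alg.ext fun p z => ?_
  rw [character, character, IsSection.toAlg_mul_apply, one_apply]
  by_cases hp : p = 0
  · simp only [hp, add_zero, if_true, ← e_add]
    rw [← e_zero]
    congr 1
    push_cast
    ring
  · simp [hp]

theorem fderiv_character (k l p : ℤ) (z : ℝ × ℝ) : fderiv ℝ ((character c hb μ ν k l).1 p) z =
    (2 * Real.pi * Complex.I * (character c hb μ ν k l).1 p z) •
      (Complex.ofRealCLM.comp ((k : ℝ) • ContinuousLinearMap.fst ℝ ℝ ℝ +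
        (l : ℝ) • ContinuousLinearMap.snd ℝ ℝ ℝ)) := by
  by_cases hp : p = 0
  · have h0 : (character c hb μ ν k l).1 p = fun z => e (k * z.1 + l * z.2) := by
      funext w
      rw [character, IsSection.toAlg_apply, if_pos hp]
    have h1 : HasFDerivAt (fun w : ℝ × ℝ => (k : ℝ) * w.1 + l * w.2)
        ((k : ℝ) • ContinuousLinearMap.fst ℝ ℝ ℝ + (l : ℝ) • ContinuousLinearMap.snd ℝ ℝ ℝ) z :=
      ((ContinuousLinearMap.fst ℝ ℝ ℝ).hasFDerivAt.const_mul _).add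
        ((ContinuousLinearMap.snd ℝ ℝ ℝ).hasFDerivAt.const_mul _)
    have h2 := ((hasDerivAt_e (k * z.1 + l * z.2)).hasFDerivAt.comp z h1).fderiv
    rw [h0]
    refine h2.trans ?_
    ext <;> simp <;> ring
  · have h0 : (character c hb μ ν k l).1 p = fun _ => 0 := by
      funext w
      rw [character, IsSection.toAlg_apply, if_neg hp]
    rw [h0, fderiv_const_apply]
    ext <;> simp

/-- Characters are joint eigenvectors: `δ_0` and `δ_1` have the eigenvalues `2πk` and `2πl`, and
`δ_2` is zero. -/
theorem δ_zero_character (α : ℝ) (k l : ℤ) : δ α 0 (character c hb μ ν k l) =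
    (2 * Real.pi * k : ℂ) • character c hb μ ν k l := by
  refine Alg.ext fun p z => ?_
  change Complex.I * (d1 (character c hb μ ν k l)).1 p z = _ * _
  rw [d1_apply, fderiv_character]
  simp
  linear_combination (-2 * Real.pi * k * (character c hb μ ν k l).1 p z) * Complex.I_mul_I

theorem δ_one_character (α : ℝ) (k l : ℤ) : δ α 1 (character c hb μ ν k l) =
    (2 * Real.pi * l : ℂ) • character c hb μ ν k l := by
  refine Alg.ext fun p z => ?_
  change Complex.I * (d2 (character c hb μ ν k l)).1 p z = _ * _
  -- The term `2πicpx` of `d₂` does not act, since the character lives at `p = 0`.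
  have h0 : (p : ℂ) * (character c hb μ ν k l).1 p z = 0 := by
    rw [character, IsSection.toAlg_apply]
    by_cases hp : p = 0 <;> simp [hp]
  rw [d2_apply, fderiv_character]
  simp
  linear_combination (-2 * Real.pi * l * (character c hb μ ν k l).1 p z) * Complex.I_mul_I +
    (2 * Real.pi * Complex.I ^ 2 * c * z.1) * h0

theorem δ_two_character (α : ℝ) (k l : ℤ) : δ α 2 (character c hb μ ν k l) = 0 := by
  rw [character, IsSection.δ_two]
  simp

/-- The section of degree `n` equal to `e(cn⌊x + θ⌋y) g(x)`, for a smooth function `g` of period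
one that vanishes near the points where `x + θ` is an integer. -/
theorem isSection_floor (c : ℕ) (n : ℤ) (θ : ℝ) {g : ℝ → ℝ} (hg : ContDiff ℝ (⊤ : ℕ∞) g)
    (hper : Function.Periodic g 1)
    (hv : ∀ m : ℤ, ∀ᶠ t in nhds (m - θ), g t = 0) :
    IsSection c n fun z => e (c * ⌊z.1 + θ⌋ * n * z.2) * g z.1 where
  contDiff := by
    rw [contDiff_iff_contDiffAt]
    rintro ⟨x, y⟩
    -- At a jump of `⌊x + θ⌋` the factor `g` is locally zero; elsewhere the floor is locally
    -- constant and the function agrees with a smooth one.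
    by_cases hx : ∃ m : ℤ, (m : ℝ) = x + θ
    · obtain ⟨m, hm⟩ := hx
      obtain rfl : x = m - θ := by linarith
      refine (contDiffAt_const (c := (0 : ℂ))).congr_of_eventuallyEq ?_
      have h := (continuous_fst (X := ℝ) (Y := ℝ)).tendsto (m - θ, y)
      filter_upwards [h.eventually (hv m)] with z hz
      simp [hz]
    · have hlt : (⌊x + θ⌋ : ℝ) < x + θ :=
        lt_of_le_of_ne (Int.floor_le _) fun h => hx ⟨_, h⟩
      have hcont : Continuous fun z : ℝ × ℝ => z.1 + θ := by fun_prop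
      have hs : ContDiff ℝ (⊤ : ℕ∞) fun z : ℝ × ℝ =>
          e (c * ⌊x + θ⌋ * n * z.2) * ((g z.1 : ℝ) : ℂ) :=
        (contDiff_e.comp (contDiff_const.mul contDiff_snd)).mul
          (Complex.ofRealCLM.contDiff.comp (hg.comp contDiff_fst))
      refine hs.contDiffAt.congr_of_eventuallyEq ?_
      filter_upwards [hcont.continuousAt.eventually (Ioo_mem_nhds (a := (⌊x + θ⌋ : ℝ))
        (b := ⌊x + θ⌋ + 1) (x := x + θ) hlt (Int.lt_floor_add_one _))] with z hz
      have : ⌊z.1 + θ⌋ = ⌊x + θ⌋ := Int.floor_eq_iff.2 ⟨hz.1.le, hz.2⟩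
      simp only [this]
  add_one x y := by
    -- The frequency `c⌊x + θ⌋n` in `y` is an integer, hence period one.
    have : (c : ℝ) * ⌊x + θ⌋ * n * (y + 1) =
        c * ⌊x + θ⌋ * n * y + ((c * ⌊x + θ⌋ * n : ℤ) : ℝ) := by
      push_cast
      ring
    simp only [this, e_add, e_int, mul_one]
  add_int k x y := by
    -- The jump of the floor by `k` produces exactly the required factor `e(ckny)`.
    have h1 : ⌊x + k + θ⌋ = ⌊x + θ⌋ + k := by
      rw [add_right_comm, Int.floor_add_intCast]
    have h2 : g (x + k) = g x := by simpa using hper.int_mul k x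
    have h3 : (c : ℝ) * (⌊x + θ⌋ + k : ℤ) * n * y = c * k * n * y + c * ⌊x + θ⌋ * n * y := by
      push_cast
      ring
    simp only [h1, h2, h3, e_add]
    ring

/-- A smooth function of period one, equal to `0` near the integers, to `1` near the
half-integers. -/
noncomputable def cutoff (x : ℝ) : ℝ := Real.smoothTransition (1 / 2 - Real.cos (2 * Real.pi * x))

theorem contDiff_cutoff : ContDiff ℝ (⊤ : ℕ∞) cutoff :=
  Real.smoothTransition.contDiff.comp
    (contDiff_const.sub (Real.contDiff_cos.comp (contDiff_const.mul contDiff_id)))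

theorem cos_periodic : Function.Periodic (fun x : ℝ => Real.cos (2 * Real.pi * x)) 1 := by
  intro x
  simp only [mul_add, mul_one, Real.cos_add_two_pi]

theorem cutoff_periodic : Function.Periodic cutoff 1 := by
  intro x
  simp only [cutoff, cos_periodic x]

theorem cutoff_eventually_zero (m : ℤ) : ∀ᶠ t in nhds (m : ℝ), cutoff t = 0 := by
  have h1 : Real.cos (2 * Real.pi * m) = 1 := by
    rw [mul_comm]
    exact Real.cos_int_mul_two_pi m
  have h2 : Continuous fun t : ℝ => Real.cos (2 * Real.pi * t) := by fun_prop
  filter_upwards [h2.continuousAt.eventually (lt_mem_nhds (a := 1 / 2)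
    (b := Real.cos (2 * Real.pi * m)) (by rw [h1]; norm_num))] with t ht
  exact Real.smoothTransition.zero_of_nonpos (by linarith)

/-- The transition is `f(t) / (f(t) + f(1 - t))`, whose denominator is symmetric under `t ↦ 1 - t`.
-/
theorem smoothTransition_one_sub (t : ℝ) :
    Real.smoothTransition (1 - t) = 1 - Real.smoothTransition t := by
  have h := Real.smoothTransition.pos_denom t
  have h' := Real.smoothTransition.pos_denom (1 - t)
  rw [sub_sub_cancel] at h'
  unfold Real.smoothTransition
  rw [sub_sub_cancel]
  field_simp
  ring

/-- A half-period translation changes the sign of the cosine and so sends the argument `t = 1/2 -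
cos(2πx)` to `1 - t`. This transfers vanishing near the integers to vanishing of `1 - cutoff` near
the half-integers. -/
theorem one_sub_cutoff (x : ℝ) : 1 - cutoff x = cutoff (x + 1 / 2) := by
  have h : 2 * Real.pi * (x + 1 / 2) = 2 * Real.pi * x + Real.pi := by ring
  rw [cutoff, cutoff, h, Real.cos_add_pi, ← smoothTransition_one_sub]
  congr 1
  ring

theorem one_sub_cutoff_eventually_zero (m : ℤ) :
    ∀ᶠ t in nhds ((m : ℝ) - 1 / 2), 1 - cutoff t = 0 := by
  have h : Filter.Tendsto (fun t : ℝ => t + 1 / 2) (nhds ((m : ℝ) - 1 / 2)) (nhds (m : ℝ)) := by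
    have h1 : Continuous fun t : ℝ => t + 1 / 2 := by fun_prop
    simpa using h1.tendsto ((m : ℝ) - 1 / 2)
  filter_upwards [h.eventually (cutoff_eventually_zero m)] with t ht
  rw [one_sub_cutoff, ht]

/-- For sections as in `isSection_floor`, of the opposite degrees `n` and `-n` and with the same
`θ`, the product is a function of `x` in degree zero. -/
theorem floor_mul_floor_apply {n : ℤ} {θ : ℝ} {g h : ℝ → ℝ}
    (hg : IsSection c n fun z => e (c * ⌊z.1 + θ⌋ * n * z.2) * g z.1)
    (hh : IsSection c (-n) fun z => e (c * ⌊z.1 + θ⌋ * (-n : ℤ) * z.2) * h z.1)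
    (p : ℤ) (z : ℝ × ℝ) :
    (hg.toAlg hb μ ν * hh.toAlg hb μ ν).1 p z =
      if p = 0 then ((g (z.1 - hb * n * μ) * h (z.1 - hb * n * μ) : ℝ) : ℂ) else 0 := by
  rw [IsSection.toAlg_mul_apply, add_neg_cancel]
  by_cases hp : p = 0
  · subst hp
    simp only [if_true, Int.cast_zero, sub_zero]
    -- For opposite degrees both factors are evaluated at the same translated point, so their phases
    -- cancel.
    rw [mul_mul_mul_comm, ← e_add]
    have : ∀ s t : ℝ, (c : ℝ) * s * n * t + c * s * (-n : ℤ) * t = 0 := fun s t => by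
      push_cast
      ring
    rw [this, e_zero]
    push_cast
    ring
  · simp [hp]

/-- There are elements `x₁, x₂` of degree one and `y₁, y₂` of degree minus one with
`x₁y₁ + x₂y₂ = 1`. -/
theorem exists_partition (c : ℕ) (hb μ ν α : ℝ) : ∃ x₁ x₂ y₁ y₂ : Alg c hb μ ν,
    x₁ * y₁ + x₂ * y₂ = 1 ∧ δ α 2 y₁ = (2 * Real.pi * c * α : ℂ) • y₁ ∧
      δ α 2 y₂ = (2 * Real.pi * c * α : ℂ) • y₂ := by
  have hs := contDiff_cutoff
  have hv0 (m : ℤ) : ∀ᶠ t in nhds ((m : ℝ) - 0), cutoff t = 0 := by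
    simpa using cutoff_eventually_zero m
  -- With `s = cutoff`, the weights satisfy `s²(3 - 2s) + (1 - s)²(1 + 2s) = 1`. Each summand splits
  -- into two smooth factors, divisible by `s` or by `1 - s`, without square roots. The offsets 0
  -- and 1/2 place the jumps where `s`, respectively `1 - s`, vanishes.
  have hX₁ := isSection_floor c 1 0 (g := fun t => cutoff t * (3 - 2 * cutoff t))
    (hs.mul (contDiff_const.sub (contDiff_const.mul hs)))
    (fun t => by simp only [cutoff_periodic t])
    (fun m => (hv0 m).mono fun t ht => by simp [ht])
  have hX₂ := isSection_floor c 1 (1 / 2) (g := fun t => (1 - cutoff t) * (1 + 2 * cutoff t))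
    ((contDiff_const.sub hs).mul (contDiff_const.add (contDiff_const.mul hs)))
    (fun t => by simp only [cutoff_periodic t])
    (fun m => (one_sub_cutoff_eventually_zero m).mono fun t ht => by simp [ht])
  have hY₁ := isSection_floor c (-1) 0 (g := cutoff) hs cutoff_periodic hv0
  have hY₂ := isSection_floor c (-1) (1 / 2) (g := fun t => 1 - cutoff t) (contDiff_const.sub hs)
    (fun t => by simp only [cutoff_periodic t]) one_sub_cutoff_eventually_zero
  refine ⟨hX₁.toAlg hb μ ν, hX₂.toAlg hb μ ν, hY₁.toAlg hb μ ν, hY₂.toAlg hb μ ν, ?_, ?_, ?_⟩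
  · refine Alg.ext fun p z => ?_
    rw [add_apply, floor_mul_floor_apply (g := fun t => cutoff t * (3 - 2 * cutoff t)) hX₁ hY₁,
      floor_mul_floor_apply (g := fun t => (1 - cutoff t) * (1 + 2 * cutoff t))
        (h := fun t => 1 - cutoff t) hX₂ hY₂, one_apply]
    by_cases hp : p = 0
    · simp only [hp, if_true]
      push_cast
      ring
    · simp [hp]
  · rw [IsSection.δ_two]
    simp
  · rw [IsSection.δ_two]
    simp

end Elements

/-! ### Every `a ⊗ σ_j` comes from a symbol, and every `f ⊗ 1` is junk -/

section Main

variable {c : ℕ} {hb μ ν α : ℝ}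

theorem character_neg_mul (k l : ℤ) :
    character c hb μ ν (-k) (-l) * character c hb μ ν k l = 1 := by
  simpa using character_mul_neg (c := c) (hb := hb) (μ := μ) (ν := ν) (-k) (-l)

/-- The scalar part `f` may be forgotten: it is junk whatever its value. -/
theorem IsSymbol.exists_of_eq {a b : Fin 3 → Alg c hb μ ν} {f : Alg c hb μ ν}
    (hb : IsSymbol α b f) (h : b = a) : ∃ f, IsSymbol α a f :=
  ⟨f, h ▸ hb⟩

theorem two_pi_ne_zero : (2 * Real.pi : ℂ) ≠ 0 :=
  mul_ne_zero two_ne_zero (Complex.ofReal_ne_zero.2 Real.pi_ne_zero)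

theorem two_pi_inv_mul : ((Real.pi : ℂ)⁻¹ * 2⁻¹) * (2 * Real.pi) = 1 := by
  rw [← mul_inv_rev, inv_mul_cancel₀ two_pi_ne_zero]

/-- The family `(a u⁻¹ δ_k(u))_k` is a symbol, for the character `u = e(kx + ly)`. -/
theorem isSymbol_character (hα : α ≠ 0) (k l : ℤ) (a : Alg c hb μ ν) :
    ∃ f, IsSymbol α ![(2 * Real.pi * k : ℂ) • a, (2 * Real.pi * l : ℂ) • a, 0] f := by
  -- This is `a u⁻¹ δu`; the inverse cancels the character reproduced by each `δ_k`.
  have h := isSymbol_mul hα (a * character c hb μ ν (-k) (-l)) (character c hb μ ν k l)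
  refine h.exists_of_eq ?_
  ext1 j
  fin_cases j
  · simp [δ_zero_character, mul_assoc, character_neg_mul]
  · simp [δ_one_character, mul_assoc, character_neg_mul]
  · simp [δ_two_character]

/-- The character `e(x)`, rescaled by its eigenvalue `2π`; `isSymbol_one` uses `e(y)` in the same
way. -/
theorem isSymbol_zero (hα : α ≠ 0) (a : Alg c hb μ ν) : ∃ f, IsSymbol α ![a, 0, 0] f := by
  obtain ⟨f, hf⟩ := isSymbol_character hα 1 0 a
  refine (hf.smul (2 * Real.pi : ℂ)⁻¹).exists_of_eq ?_
  ext1 j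
  fin_cases j <;> simp [smul_smul, two_pi_inv_mul]

theorem isSymbol_one (hα : α ≠ 0) (a : Alg c hb μ ν) : ∃ f, IsSymbol α ![0, a, 0] f := by
  obtain ⟨f, hf⟩ := isSymbol_character hα 0 1 a
  refine (hf.smul (2 * Real.pi : ℂ)⁻¹).exists_of_eq ?_
  ext1 j
  fin_cases j <;> simp [smul_smul, two_pi_inv_mul]

/-- Since `δ_2(y_i) = 2πcα y_i`, the relation `x₁y₁ + x₂y₂ = 1` turns the last component of `a x₁
δy₁ + a x₂ δy₂` into `2πcα a`. Dividing by this constant is possible because `c` and `α` are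
nonzero. -/
theorem isSymbol_two (hc : c ≠ 0) (hα : α ≠ 0) (a : Alg c hb μ ν) :
    ∃ f, IsSymbol α ![0, 0, a] f := by
  obtain ⟨x₁, x₂, y₁, y₂, h1, h2, h3⟩ := exists_partition c hb μ ν α
  have h := (isSymbol_mul hα (a * x₁) y₁).add (isSymbol_mul hα (a * x₂) y₂)
  -- These two symbols cancel the components of index 0 and 1 and leave the last one unchanged.
  obtain ⟨f, hf⟩ := isSymbol_zero hα (-(a * x₁ * δ α 0 y₁ + a * x₂ * δ α 0 y₂))
  obtain ⟨g, hg⟩ := isSymbol_one hα (-(a * x₁ * δ α 1 y₁ + a * x₂ * δ α 1 y₂))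
  have hα' : (2 * Real.pi * c * α : ℂ) ≠ 0 :=
    mul_ne_zero (mul_ne_zero two_pi_ne_zero (Nat.cast_ne_zero.2 hc)) (Complex.ofReal_ne_zero.2 hα)
  refine (((h.add hf).add hg).smul (2 * Real.pi * c * α : ℂ)⁻¹).exists_of_eq ?_
  ext1 j
  fin_cases j
  · change (2 * Real.pi * c * α : ℂ)⁻¹ • (a * x₁ * δ α 0 y₁ + a * x₂ * δ α 0 y₂ +
      -(a * x₁ * δ α 0 y₁ + a * x₂ * δ α 0 y₂) + 0) = 0
    rw [add_neg_cancel, add_zero, smul_zero]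
  · change (2 * Real.pi * c * α : ℂ)⁻¹ • (a * x₁ * δ α 1 y₁ + a * x₂ * δ α 1 y₂ + 0 +
      -(a * x₁ * δ α 1 y₁ + a * x₂ * δ α 1 y₂)) = 0
    rw [add_zero, add_neg_cancel, smul_zero]
  · have e1 : a * x₁ * δ α 2 y₁ + a * x₂ * δ α 2 y₂ = (2 * Real.pi * c * α : ℂ) • a := by
      rw [h2, h3, alg_mul_smul, alg_mul_smul, ← smul_add, mul_assoc a, mul_assoc a, ← mul_add, h1,
        mul_one]
    change (2 * Real.pi * c * α : ℂ)⁻¹ • (a * x₁ * δ α 2 y₁ + a * x₂ * δ α 2 y₂ + 0 + 0) = a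
    rw [e1, add_zero, add_zero, smul_smul, inv_mul_cancel₀ hα', one_smul]

/-- The operators `f ⊗ 1` are junk. -/
theorem tens_one_mem_junk (hα : α ≠ 0) (f : Alg c hb μ ν) :
    tens f 1 ∈ junk (πQ c hb μ ν α) 2 := by
  set u := character c hb μ ν 1 0 with hu
  set v := character c hb μ ν (-1) 0 with hv
  have huv : u * v = 1 := by
    simpa using character_mul_neg (c := c) (hb := hb) (μ := μ) (ν := ν) 1 0
  have hvu : v * u = 1 := by
    simpa using character_neg_mul (c := c) (hb := hb) (μ := μ) (ν := ν) 1 0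
  have hu0 : δ α 0 u = (2 * Real.pi : ℂ) • u := by simpa using δ_zero_character α 1 0
  have hv0 : δ α 0 v = (-(2 * Real.pi) : ℂ) • v := by
    simpa using δ_zero_character (c := c) (hb := hb) (μ := μ) (ν := ν) α (-1) 0
  have hu1 : δ α 1 u = 0 := by simpa using δ_one_character α 1 0
  have hv1 : δ α 1 v = 0 := by simpa using δ_one_character α (-1) 0
  have hu2 : δ α 2 u = 0 := δ_two_character α 1 0
  have hv2 : δ α 2 v = 0 := δ_two_character α (-1) 0
  -- The normalising constant: `2π(δ_0(f) - 2πf) - 2π(δ_0(f) + 2πf) = -2(2π)² f`, where the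
  -- derivatives of `f` cancel.
  set r : ℂ := (-2 * (2 * Real.pi) ^ 2)⁻¹ with hr
  have hr0 : (-2 * (2 * Real.pi) ^ 2 : ℂ) ≠ 0 :=
    mul_ne_zero (by norm_num) (pow_ne_zero 2 two_pi_ne_zero)
  have h := ((isSymbol_mul hα (f * v) u).add (isSymbol_mul hα (f * u) v)).smul r
  -- The components of index 0 are `2πf` and `-2πf`; all others vanish. So the form lies in `J_1`.
  have e1 : r • ((fun k => f * v * δ α k u) + fun k => f * u * δ α k v) = 0 := by
    ext1 j
    fin_cases j <;>
      simp [hu0, hv0, hu1, hv1, hu2, hv2, mul_assoc, huv, hvu]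
  have e2 : r • (∑ k, δ α k (f * v) * δ α k u + ∑ k, δ α k (f * u) * δ α k v) = f := by
    simp only [Fin.sum_univ_three, hu0, hv0, hu1, hv1, hu2, hv2, δ_mul, add_mul, mul_zero,
      add_zero, alg_mul_smul, alg_smul_mul, mul_assoc, huv, hvu, mul_one]
    have e3 : (2 * Real.pi : ℂ) • (δ α 0 f + (-(2 * Real.pi) : ℂ) • f) +
        (-(2 * Real.pi) : ℂ) • (δ α 0 f + (2 * Real.pi : ℂ) • f) =
        (-2 * (2 * Real.pi) ^ 2 : ℂ) • f := by module
    have e4 : r • (-2 * (2 * Real.pi) ^ 2 : ℂ) • f = f := by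
      rw [smul_smul, hr, inv_mul_cancel₀ hr0, one_smul]
    refine Eq.trans (congrArg (r • ·) ?_) e4
    rw [← e3, smul_add, smul_add]
  rw [e1, e2] at h
  obtain ⟨ω, hω, h1, h2⟩ := h
  have z1 : oneForm (0 : Fin 3 → Alg c hb μ ν) = 0 := by
    simp [oneForm, tens_zero]
  have z2 : twoForm α (0 : Fin 3 → Alg c hb μ ν) = 0 := by
    simp [twoForm, tens_zero]
  rw [z2, zero_add] at h2
  rw [z1] at h1
  rw [← h2]
  -- A form in the kernel of `π` whose differential is represented by `f ⊗ 1` exhibits this operator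
  -- as junk.
  exact Submodule.mem_map_of_mem (Submodule.mem_map_of_mem ⟨hω, h1⟩)

end Main

end QHM

theorem mainTheorem2 (c : ℕ) (hc : 0 < c) (hb μ ν : ℝ) (hμν : μ ^ 2 + ν ^ 2 ≠ 0)
    (α : ℝ) (hα : 1 < α) :
    (∀ a : QHM.Alg c hb μ ν,
      QHM.DTildeEq c hb μ ν α 0 (QHM.tens a 1) (∑ j, QHM.tens (QHM.δ α j a) (QHM.σ j))) ∧
    (∀ a : QHM.Alg c hb μ ν,
      QHM.DTildeEq c hb μ ν α 1 (QHM.tens a (QHM.σ 0))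
        (QHM.tens (QHM.δ α 1 a) (QHM.σ 1 * QHM.σ 0) +
          QHM.tens (QHM.δ α 2 a) (QHM.σ 2 * QHM.σ 0))) ∧
    (∀ a : QHM.Alg c hb μ ν,
      QHM.DTildeEq c hb μ ν α 1 (QHM.tens a (QHM.σ 1))
        (QHM.tens (QHM.δ α 0 a) (QHM.σ 0 * QHM.σ 1) +
          QHM.tens (QHM.δ α 2 a) (QHM.σ 2 * QHM.σ 1))) ∧
    (∀ a : QHM.Alg c hb μ ν,
      QHM.DTildeEq c hb μ ν α 1 (QHM.tens a (QHM.σ 2))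
        (QHM.tens (QHM.δ α 0 a) (QHM.σ 0 * QHM.σ 2) +
          QHM.tens (QHM.δ α 1 a) (QHM.σ 1 * QHM.σ 2) +
          (Complex.I / (α : ℂ)) • QHM.tens a (QHM.σ 0 * QHM.σ 1))) := by
  have hα0 : α ≠ 0 := (zero_lt_one.trans hα).ne'
  refine ⟨QHM.dTildeEq_zero α, fun a => ?_, fun a => ?_, fun a => ?_⟩
  · obtain ⟨f, hf⟩ := QHM.isSymbol_zero hα0 a
    convert hf.dTildeEq (QHM.tens_one_mem_junk hα0 f) using 1
    · simp [QHM.oneForm, QHM.tens_zero]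
    -- The coefficients `-δ_1(a)` and `-δ_2(a)` stand at `σ_0σ_1` and `σ_0σ_2`; reversing the order
    -- of the matrices absorbs the signs.
    · simp [QHM.twoForm, QHM.tens_zero, QHM.tens_neg, QHM.σ_one_zero, QHM.σ_two_zero,
        QHM.tens_neg_right]
  · obtain ⟨f, hf⟩ := QHM.isSymbol_one hα0 a
    convert hf.dTildeEq (QHM.tens_one_mem_junk hα0 f) using 1
    · simp [QHM.oneForm, QHM.tens_zero]
    · simp [QHM.twoForm, QHM.tens_zero, QHM.tens_neg, QHM.σ_two_one, QHM.tens_neg_right]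
  · obtain ⟨f, hf⟩ := QHM.isSymbol_two hc.ne' hα0 a
    convert hf.dTildeEq (QHM.tens_one_mem_junk hα0 f) using 1
    · simp [QHM.oneForm, QHM.tens_zero]
    -- Only here is the component of index 2 nonzero, so that the Heisenberg term `(i/α) a`
    -- survives.
    · simp only [QHM.twoForm, Matrix.cons_val, map_zero, sub_zero, zero_add, QHM.tens_smul]
      abel
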